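/- Let $\mathbb K$ be a field. A braided algebra $(V,\sigma,m)$ is a $\mathbb K$-vector space with linear maps $\sigma:V\otimes V\to V\otimes V$ and $m:V\otimes V\to V$ such that $m$ is associative, $\sigma_1\sigma_2\sigma_1=\sigma_2\sigma_1\sigma_2$ on $V^{\otimes 3}$, $\sigma(\mathrm{id}\otimes m)=(m\otimes\mathrm{id})\sigma_2\sigma_1$ and $\sigma(m\otimes\mathrm{id})=(\mathrm{id}\otimes m)\sigma_1\sigma_2$, where $\sigma_i=\mathrm{id}^{\otimes(i-1)}\otimes\sigma\otimes\mathrm{id}^{\otimes(n-i-1)}$ on $V^{\otimes n}$ (invertibility of $\sigma$ is not needed). Let $(\widehat V,\sigma,m)$ be a braided algebra with an element $\mathbf 1\neq 0$ such that $m(\mathbf 1\otimes v)=m(v\otimes\mathbf 1)=v$, $\sigma(\mathbf 1\otimes v)=v\otimes\mathbf 1$ and $\sigma(v\otimes\mathbf 1)=\mathbf 1\otimes v$ for all $v\in\widehat V$, and let $V$ be a linear complement of $\mathbb K\mathbf 1$ such that $\sigma,m$ restrict to a braided algebra $(V,\sigma,m)$. *Quantum quasi-shuffle algebra.* $T_{\sigma,m}(V)$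 is the tensor space $T(V)=\bigoplus_{n\ge0}V^{\otimes n}$ with the bilinear product $\ast$ for which scalars act by scalar multiplication and whose components $\ast_{i,j}$ on $V^{\otimes i}\otimes V^{\otimes j}$ satisfy, for $i,j\ge1$, $$\ast_{i,j}=(\mathrm{id}\otimes\ast_{i-1,j})+(\mathrm{id}\otimes\ast_{i,j-1})(\beta_{i,1}\otimes\mathrm{id}^{\otimes(j-1)})+(m\otimes\ast_{i-1,j-1})(\mathrm{id}\otimes\beta_{i-1,1}\otimes\mathrm{id}^{\otimes(j-1)}),$$ where $\beta_{i,1}=\sigma_1\sigma_2\cdots\sigma_i:V^{\otimes i}\otimes V\to V\otimes V^{\otimes i}$. The quantum quasi-shuffle algebra $Q_{\sigma,m}(V)$ is the unital subalgebra of $T_{\sigma,m}(V)$ generated by $V$. *Total symmetrization.* $\mathrm{GVB}_n^+$ is the monoid with generators $\sigma_i,\xi_i$ ($1\le i\le n-1$) and relations $\sigma_i\sigma_j=\sigma_j\sigma_i$, $\sigma_i\xi_j=\xi_j\sigma_i$, $\xi_i\xi_j=\xi_j\xi_i$ for $|i-j|>1$, and $\sigma_i\sigma_{i+1}\sigma_i=\sigma_{i+1}\sigma_i\sigma_{i+1}$,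 $\xi_i\xi_{i+1}\xi_i=\xi_{i+1}\xi_i\xi_{i+1}$, $\xi_i\sigma_{i+1}\sigma_i=\sigma_{i+1}\sigma_i\xi_{i+1}$, $\xi_{i+1}\sigma_i\sigma_{i+1}=\sigma_i\sigma_{i+1}\xi_i$. Let $l_v(\tau)$ be the number of letters $\xi_i$ in $\tau$, and let $x\mapsto x^{\uparrow l}$ be the shift of all indices by $l$. The algebra $\mathbb K[\mathrm{GVB}_n^+]$ acts on $\widehat V^{\otimes n}$, $\sigma_i$ by $\sigma$ and $\xi_i$ by $v\otimes w\mapsto\mathbf 1\otimes m(v\otimes w)$ in positions $i,i+1$. Let $s_i=(i\ i{+}1)$ and $\mathfrak S_{k,1}=\{e\}\cup\{s_ts_{t+1}\cdots s_k:1\le t\le k\}$. For $k\ge 1$ put $Q_{k,1}(e)=e$ and $$Q_{k,1}(s_t\cdots s_k)=(\sigma_t+\sigma_1\cdots\sigma_{t-1}\xi_t)\,\sigma_{t+1}\cdots\sigma_k .$$ For $s\in\mathfrak S_n$, $\tau\in\mathrm{GVB}_n^+$ and $l=l_v(\tau)$, put $\mathbf M_{k,1}(s,\tau)=Q_{k-l,1}(r)^{\uparrow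 l}\,\tau$ if $l<k$ and $s=r^{\uparrow l}$ with $r\in\mathfrak S_{k-l,1}$, and $\mathbf M_{k,1}(s,\tau)=0$ otherwise; extend linearly in $\tau$. Every $s\in\mathfrak S_n$ is uniquely a product $s=s^{(n-1)}\cdots s^{(2)}s^{(1)}$ with $s^{(k)}\in\mathfrak S_{k,1}$; let $Q(s)=\mathbf M_{n-1,1}(s^{(n-1)},\cdots\mathbf M_{2,1}(s^{(2)},\mathbf M_{1,1}(s^{(1)},e))\cdots)$ (and $Q(e)=e$ if $n\le1$), and $Q_n=\sum_{s\in\mathfrak S_n}Q(s)$. Let $\mathbf D:T(\widehat V)\to T(V)$ be the linear map that deletes all factors $\mathbf 1$ from every pure tensor whose factors are $\mathbf 1$ or elements of $V$. Put $\mathrm{QS}_n=\mathbf D\circ Q_n:V^{\otimes n}\to T(V)$ (with $V^{\otimes n}\subset\widehat V^{\otimes n}$) and $\mathrm{QS}=\sum_{n\ge0}\mathrm{QS}_n\in\operatorname{End}(T(V))$. **Corollary.** $Q_{\sigma,m}(V)=\operatorname{im}\mathrm{QS}$. -/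

import Mathlib

open scoped TensorProduct DirectSum

noncomputable section

namespace QuasiShuffle

universe u v

/-! ### Tensor powers -/

section TensorPowers

variable {K : Type u} [Field K] {V : Type v} [AddCommGroup V] [Module K V]

/-- Prepending a tensor factor: `v ⊗ (v₁ ⊗ ⋯ ⊗ vₙ) ↦ v ⊗ v₁ ⊗ ⋯ ⊗ vₙ`. -/
def cons (n : ℕ) : V ⊗[K] (⨂[K]^n V) →ₗ[K] ⨂[K]^(n + 1) V :=
  TensorProduct.lift
    { toFun := fun v =>
        PiTensorProduct.lift
          ((PiTensorProduct.tprod K : MultilinearMap K (fun _ : Fin (n + 1) => V) _).curryLeft v)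
      map_add' := fun v w => by
        ext x
        simp
      map_smul' := fun c v => by
        ext x
        simp }

theorem cons_tmul_tprod (n : ℕ) (v : V) (x : Fin n → V) :
    cons (K := K) n (v ⊗ₜ PiTensorProduct.tprod K x) =
      PiTensorProduct.tprod K (Fin.cons v x : Fin (n + 1) → V) := by
  simp [cons]

/-- Splitting off the first tensor factor. -/
def uncons (n : ℕ) : ⨂[K]^(n + 1) V →ₗ[K] V ⊗[K] (⨂[K]^n V) :=
  PiTensorProduct.lift
    (LinearMap.uncurryLeft (M := fun _ : Fin (n + 1) => V)
      { toFun := fun v =>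
          (TensorProduct.mk K V (⨂[K]^n V) v).compMultilinearMap (PiTensorProduct.tprod K)
        map_add' := fun v w => by
          ext x
          simp
        map_smul' := fun c v => by
          ext x
          simp [TensorProduct.smul_tmul'] })

theorem uncons_tprod (n : ℕ) (x : Fin (n + 1) → V) :
    uncons (K := K) n (PiTensorProduct.tprod K x) =
      x 0 ⊗ₜ PiTensorProduct.tprod K (Fin.tail x) := by
  simp [uncons]

/-- The canonical isomorphism `V ⊗ V^{⊗n} ≃ V^{⊗(n+1)}`. -/
def consEquiv (n : ℕ) : V ⊗[K] (⨂[K]^n V) ≃ₗ[K] ⨂[K]^(n + 1) V :=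
  LinearEquiv.ofLinearMap (cons n) (uncons n)
    (by
      ext x
      simp [uncons_tprod, cons_tmul_tprod])
    (by
      ext v x
      simp [uncons_tprod, cons_tmul_tprod])

/-- The isomorphism `V^{⊗(n+2)} ≃ V ⊗ (V ⊗ V^{⊗n})`. -/
def split₂ (n : ℕ) : ⨂[K]^(n + 2) V ≃ₗ[K] V ⊗[K] (V ⊗[K] (⨂[K]^n V)) :=
  (consEquiv (n + 1)).symm ≪≫ₗ LinearEquiv.lTensor V (consEquiv n).symm

/-- `f ⊗ id : V ⊗ (V ⊗ X) → V ⊗ (V ⊗ X)` for `f : V ⊗ V → V ⊗ V`. -/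
def onFirstTwo (f : V ⊗[K] V →ₗ[K] V ⊗[K] V) (X : Type*) [AddCommGroup X] [Module K X] :
    V ⊗[K] (V ⊗[K] X) →ₗ[K] V ⊗[K] (V ⊗[K] X) :=
  (TensorProduct.assoc K V V X).toLinearMap ∘ₗ f.rTensor X ∘ₗ
    (TensorProduct.assoc K V V X).symm.toLinearMap

/-- The operator `id^{⊗ i} ⊗ f ⊗ id^{⊗ (n-i-2)}` on `V^{⊗n}`, for `f : V ⊗ V → V ⊗ V` and
`i + 2 ≤ n`. For `i + 2 > n` the value is `0` (this case is never used). -/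
def localOp (f : V ⊗[K] V →ₗ[K] V ⊗[K] V) : (n : ℕ) → (i : ℕ) → Module.End K (⨂[K]^n V)
  | n + 2, 0 => (split₂ n).symm.conj (onFirstTwo f (⨂[K]^n V))
  | n + 1, i + 1 => (consEquiv n).conj ((localOp f n i).lTensor V)
  | 0, _ => 0
  | 1, 0 => 0

end TensorPowers

/-! ### Generalized virtual braid monoids -/

/-- The generators `σ_i`, `ξ_i`, `1 ≤ i ≤ n - 1`. -/
inductive GVBGen (n : ℕ) : Type
  | braid (i : ℕ) (h : 1 ≤ i ∧ i < n) : GVBGen n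
  | virt (i : ℕ) (h : 1 ≤ i ∧ i < n) : GVBGen n

open GVBGen FreeMonoid in
/-- The defining relations of the generalized virtual braid monoid. -/
inductive GVBRel (n : ℕ) : FreeMonoid (GVBGen n) → FreeMonoid (GVBGen n) → Prop
  | far_bb (i j : ℕ) (hi hj) (h : i + 1 < j ∨ j + 1 < i) :
      GVBRel n (of (braid i hi) * of (braid j hj)) (of (braid j hj) * of (braid i hi))
  | far_bv (i j : ℕ) (hi hj) (h : i + 1 < j ∨ j + 1 < i) :
      GVBRel n (of (braid i hi) * of (virt j hj)) (of (virt j hj) * of (braid i hi))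
  | far_vv (i j : ℕ) (hi hj) (h : i + 1 < j ∨ j + 1 < i) :
      GVBRel n (of (virt i hi) * of (virt j hj)) (of (virt j hj) * of (virt i hi))
  | bbb (i : ℕ) (h h') :
      GVBRel n (of (braid i h) * of (braid (i + 1) h') * of (braid i h))
        (of (braid (i + 1) h') * of (braid i h) * of (braid (i + 1) h'))
  | vvv (i : ℕ) (h h') :
      GVBRel n (of (virt i h) * of (virt (i + 1) h') * of (virt i h))
        (of (virt (i + 1) h') * of (virt i h) * of (virt (i + 1) h'))
  | vbb (i : ℕ) (h h') :
      GVBRel n (of (virt i h) * of (braid (i + 1) h') * of (braid i h))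
        (of (braid (i + 1) h') * of (braid i h) * of (virt (i + 1) h'))
  | vbb' (i : ℕ) (h h') :
      GVBRel n (of (virt (i + 1) h') * of (braid i h) * of (braid (i + 1) h'))
        (of (braid i h) * of (braid (i + 1) h') * of (virt i h))

/-- The generalized virtual braid monoid `GVB_n^+`. -/
abbrev GVB (n : ℕ) : Type := PresentedMonoid (GVBRel n)

/-- The virtual length `l_v`: the number of occurrences of the generators `ξ_i`. -/
def virtLength (n : ℕ) : GVB n →* Multiplicative ℕ :=
  PresentedMonoid.lift
    (fun g => match g with
      | .braid _ _ => 1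
      | .virt _ _ => Multiplicative.ofAdd 1)
    (by
      intro a b h
      cases h <;> simp)

/-- The arrow map on generators: `σ_i ↦ σ_{i+k}`, `ξ_i ↦ ξ_{i+k}`. -/
def arrowGen {m n : ℕ} (k : ℕ) (hk : k + m ≤ n) : GVBGen m → GVB n
  | .braid i h => PresentedMonoid.of _ (.braid (k + i) (by omega))
  | .virt i h => PresentedMonoid.of _ (.virt (k + i) (by omega))

/-- The arrow map `i_k : GVB_m^+ → GVB_n^+`, `σ_i ↦ σ_{i+k}`, `ξ_i ↦ ξ_{i+k}`. -/
def arrow {m n : ℕ} (k : ℕ) (hk : k + m ≤ n) : GVB m →* GVB n :=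
  PresentedMonoid.lift (arrowGen k hk)
    (by
      intro a b h
      cases h with
      | far_bb i j hi hj h =>
        exact PresentedMonoid.mk_eq_mk_of_rel
          (GVBRel.far_bb (n := n) (k + i) (k + j) (by omega) (by omega) (by omega))
      | far_bv i j hi hj h =>
        exact PresentedMonoid.mk_eq_mk_of_rel
          (GVBRel.far_bv (n := n) (k + i) (k + j) (by omega) (by omega) (by omega))
      | far_vv i j hi hj h =>
        exact PresentedMonoid.mk_eq_mk_of_rel
          (GVBRel.far_vv (n := n) (k + i) (k + j) (by omega) (by omega) (by omega))
      | bbb i h h' =>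
        exact PresentedMonoid.mk_eq_mk_of_rel
          (GVBRel.bbb (n := n) (k + i) (by omega) (by omega))
      | vvv i h h' =>
        exact PresentedMonoid.mk_eq_mk_of_rel
          (GVBRel.vvv (n := n) (k + i) (by omega) (by omega))
      | vbb i h h' =>
        exact PresentedMonoid.mk_eq_mk_of_rel
          (GVBRel.vbb (n := n) (k + i) (by omega) (by omega))
      | vbb' i h h' =>
        exact PresentedMonoid.mk_eq_mk_of_rel
          (GVBRel.vbb' (n := n) (k + i) (by omega) (by omega)))

/-! ### Braided algebras -/

/-- A braided algebra (not necessarily unital): an associative algebra with a solution of the braid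
equation on `V ⊗ V` which is compatible with the multiplication. -/
structure BraidedAlgebra (K : Type u) [Field K] (V : Type v) [AddCommGroup V] [Module K V] where
  /-- the braiding -/
  σ : V ⊗[K] V →ₗ[K] V ⊗[K] V
  /-- the multiplication -/
  m : V ⊗[K] V →ₗ[K] V
  /-- the braid equation `σ₁ σ₂ σ₁ = σ₂ σ₁ σ₂` -/
  braid_eq : onFirstTwo σ V ∘ₗ σ.lTensor V ∘ₗ onFirstTwo σ V =
    σ.lTensor V ∘ₗ onFirstTwo σ V ∘ₗ σ.lTensor V
  /-- associativity `m (m ⊗ id) = m (id ⊗ m)` -/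
  m_assoc : m ∘ₗ m.rTensor V = m ∘ₗ m.lTensor V ∘ₗ (TensorProduct.assoc K V V V).toLinearMap
  /-- `σ (id ⊗ m) = (m ⊗ id) σ₂ σ₁` -/
  σ_m_right : σ ∘ₗ m.lTensor V =
    m.rTensor V ∘ₗ (TensorProduct.assoc K V V V).symm.toLinearMap ∘ₗ
      σ.lTensor V ∘ₗ onFirstTwo σ V
  /-- `σ (m ⊗ id) = (id ⊗ m) σ₁ σ₂` -/
  σ_m_left : σ ∘ₗ m.rTensor V ∘ₗ (TensorProduct.assoc K V V V).symm.toLinearMap =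
    m.lTensor V ∘ₗ onFirstTwo σ V ∘ₗ σ.lTensor V

/-! ### The quantum quasi-shuffle algebra -/

namespace BraidedAlgebra

variable {K : Type u} [Field K] {V : Type v} [AddCommGroup V] [Module K V]
variable (A : BraidedAlgebra K V)

/-- The braiding `β_{i,1} : V^{⊗i} ⊗ V → V ⊗ V^{⊗i}`, given by `σ₁ σ₂ ⋯ σ_i`. -/
def β : (i : ℕ) → (⨂[K]^i V) ⊗[K] V →ₗ[K] V ⊗[K] (⨂[K]^i V)
  | 0 => (TensorProduct.comm K (⨂[K]^0 V) V).toLinearMap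
  | i + 1 =>
      (consEquiv i).toLinearMap.lTensor V ∘ₗ
      (TensorProduct.assoc K V V (⨂[K]^i V)).toLinearMap ∘ₗ
      A.σ.rTensor (⨂[K]^i V) ∘ₗ
      (TensorProduct.assoc K V V (⨂[K]^i V)).symm.toLinearMap ∘ₗ
      (β i).lTensor V ∘ₗ
      (TensorProduct.assoc K V (⨂[K]^i V) V).toLinearMap ∘ₗ
      (consEquiv i).symm.toLinearMap.rTensor V

/-- Concatenation `v ⊗ t ↦ v t` from `V ⊗ T(V)` to `T(V)`. -/
def prepend : V ⊗[K] TensorAlgebra K V →ₗ[K] TensorAlgebra K V :=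
  LinearMap.mul' K (TensorAlgebra K V) ∘ₗ (TensorAlgebra.ι K).rTensor (TensorAlgebra K V)

/-- The quantum quasi-shuffle product `V^{⊗i} ⊗ V^{⊗j} → T(V)`, defined inductively: a scalar acts
by scalar multiplication, and
`∗_{i+1,j+1} = (id ⊗ ∗_{i,j+1}) + (id ⊗ ∗_{i+1,j}) (β_{i+1,1} ⊗ id) + (m ⊗ ∗_{i,j}) (id ⊗ β_{i,1} ⊗ id)`. -/
def qsPart : (i j : ℕ) → (⨂[K]^i V) ⊗[K] (⨂[K]^j V) →ₗ[K] TensorAlgebra K V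
  | 0, _ =>
      LinearMap.mul' K (TensorAlgebra K V) ∘ₗ
        TensorProduct.map TensorPower.toTensorAlgebra TensorPower.toTensorAlgebra
  | _ + 1, 0 =>
      LinearMap.mul' K (TensorAlgebra K V) ∘ₗ
        TensorProduct.map TensorPower.toTensorAlgebra TensorPower.toTensorAlgebra
  | i + 1, j + 1 =>
      prepend ∘ₗ (qsPart i (j + 1)).lTensor V ∘ₗ
          (TensorProduct.assoc K V (⨂[K]^i V) (⨂[K]^(j + 1) V)).toLinearMap ∘ₗ
          (consEquiv i).symm.toLinearMap.rTensor (⨂[K]^(j + 1) V)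
        + prepend ∘ₗ (qsPart (i + 1) j).lTensor V ∘ₗ
          (TensorProduct.assoc K V (⨂[K]^(i + 1) V) (⨂[K]^j V)).toLinearMap ∘ₗ
          (A.β (i + 1)).rTensor (⨂[K]^j V) ∘ₗ
          (TensorProduct.assoc K (⨂[K]^(i + 1) V) V (⨂[K]^j V)).symm.toLinearMap ∘ₗ
          (consEquiv j).symm.toLinearMap.lTensor (⨂[K]^(i + 1) V)
        + prepend ∘ₗ TensorProduct.map A.m (qsPart i j) ∘ₗ
          (TensorProduct.assoc K V V ((⨂[K]^i V) ⊗[K] (⨂[K]^j V))).symm.toLinearMap ∘ₗ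
          (TensorProduct.assoc K V (⨂[K]^i V) (⨂[K]^j V)).toLinearMap.lTensor V ∘ₗ
          ((A.β i).rTensor (⨂[K]^j V)).lTensor V ∘ₗ
          (TensorProduct.assoc K (⨂[K]^i V) V (⨂[K]^j V)).symm.toLinearMap.lTensor V ∘ₗ
          (TensorProduct.assoc K V (⨂[K]^i V) (V ⊗[K] (⨂[K]^j V))).toLinearMap ∘ₗ
          TensorProduct.map (consEquiv i).symm.toLinearMap (consEquiv j).symm.toLinearMap
termination_by i j => (i, j)

/-- The multiplication `∗` of `T_{σ,m}(V)`: the bilinear extension to `T(V) = ⨁ V^{⊗n}` of the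
quantum quasi-shuffle products on `V^{⊗i} × V^{⊗j}`. -/
def qsMul : TensorAlgebra K V →ₗ[K] TensorAlgebra K V →ₗ[K] TensorAlgebra K V :=
  LinearMap.compl₁₂
    (DirectSum.toModule K ℕ ((⨁ n, ⨂[K]^n V) →ₗ[K] TensorAlgebra K V) fun i =>
      LinearMap.flip (DirectSum.toModule K ℕ ((⨂[K]^i V) →ₗ[K] TensorAlgebra K V) fun j =>
        LinearMap.flip (TensorProduct.curry (A.qsPart i j))))
    TensorAlgebra.equivDirectSum.toLinearMap TensorAlgebra.equivDirectSum.toLinearMap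

/-- The quantum quasi-shuffle algebra `Q_{σ,m}(V)`: the (unital) subalgebra of `T_{σ,m}(V)`
generated by `V`, i.e. the smallest linear subspace of `T(V)` which contains `1` and `V` and is
closed under `∗`. -/
def quasiShuffleAlgebra : Submodule K (TensorAlgebra K V) :=
  sInf {S | 1 ∈ S ∧ (∀ v : V, TensorAlgebra.ι K v ∈ S) ∧ ∀ x ∈ S, ∀ y ∈ S, A.qsMul x y ∈ S}

end BraidedAlgebra

/-! ### Permutations, shuffles and the bubble decomposition

Permutations multiply as functions, `(s * t) i = s (t i)`, and a permutation moves the entry in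
position `i` to position `s i`. Positions are elements of `Fin n`; the transpositions
`s_i`, `1 ≤ i ≤ n - 1`, are numbered from `1`. -/

section Permutations

/-- `(p,q)`-shuffles: the first `p` entries and the last `q` entries each keep their order. -/
def IsShuffle (p q : ℕ) (s : Equiv.Perm (Fin (p + q))) : Prop :=
  StrictMonoOn s {i | (i : ℕ) < p} ∧ StrictMonoOn s {i | p ≤ (i : ℕ)}

/-- The arrow map `𝔖_m → 𝔖_n`, `s_i ↦ s_{i+k}`. -/
def permArrow {m n : ℕ} (k : ℕ) (hk : k + m ≤ n) (s : Equiv.Perm (Fin m)) :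
    Equiv.Perm (Fin n) :=
  s.viaEmbedding ((Fin.natAddEmb k).trans (Fin.castLEEmb hk))

/-- The transposition `s_i = (i, i+1)`, for `1 ≤ i ≤ n - 1`. -/
def adjSwap (n i : ℕ) : Equiv.Perm (Fin n) :=
  if h : 1 ≤ i ∧ i < n then Equiv.swap ⟨i - 1, by omega⟩ ⟨i, h.2⟩ else 1

/-- The element `s_t s_{t+1} ⋯ s_k` of `𝔖_{k,1} ⊆ 𝔖_n` for `1 ≤ t ≤ k`; the identity for `t = 0`. -/
def bubble (n k t : ℕ) : Equiv.Perm (Fin n) :=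
  if t = 0 then 1 else ((List.Ico t (k + 1)).map (adjSwap n)).prod

/-- The index `t_k(s)` of the bubble decomposition. With entries numbered from `1`, the number
`c` of entries among the first `k + 1` which are moved to or before the final position of the
`(k+1)`-st is `t_k(s)`, unless `c = k + 1`, in which case the factor is trivial and
`t_k(s) = 0`. -/
def bubbleIndex {n : ℕ} (s : Equiv.Perm (Fin n)) (k : ℕ) : ℕ :=
  if h : k < n then
    let c := (Finset.univ.filter fun j : Fin n => (j : ℕ) ≤ k ∧ s j ≤ s ⟨k, h⟩).card
    if c = k + 1 then 0 else c
  else 0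

/-- The factor `s^{(k)} ∈ 𝔖_{k,1}` of the bubble decomposition of `s`. -/
def bubbleFactor {n : ℕ} (s : Equiv.Perm (Fin n)) (k : ℕ) : Equiv.Perm (Fin n) :=
  bubble n k (bubbleIndex s k)

end Permutations

/-! ### Lifting permutations -/

section Lifting

variable (K : Type u) [Field K]

/-- `σ_i` in `K[GVB_n^+]`, for `1 ≤ i ≤ n - 1`. -/
def braidElt (n i : ℕ) : MonoidAlgebra K (GVB n) :=
  if h : 1 ≤ i ∧ i < n then MonoidAlgebra.of K _ (PresentedMonoid.of _ (.braid i h)) else 0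

/-- `ξ_i` in `K[GVB_n^+]`, for `1 ≤ i ≤ n - 1`. -/
def virtElt (n i : ℕ) : MonoidAlgebra K (GVB n) :=
  if h : 1 ≤ i ∧ i < n then MonoidAlgebra.of K _ (PresentedMonoid.of _ (.virt i h)) else 0

/-- `σ_a σ_{a+1} ⋯ σ_b` (equal to `1` if `b < a`). -/
def braidRun (n a b : ℕ) : MonoidAlgebra K (GVB n) :=
  ((List.Ico a (b + 1)).map (braidElt K n)).prod

open Classical in
/-- The lift `Q_{p,q}` of `(p,q)`-shuffles, extended by zero to all permutations:
`s ↦ ∏ (σ_{t_k} + (1 - δ_{t_k + 1, t_{k+1}}) σ_1 ⋯ σ_{t_k - 1} ξ_{t_k}) σ_{t_k + 1} ⋯ σ_k`, the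
product being over all `k` with `s^{(k)} ≠ e`, in descending order. -/
def liftShuffle (p q : ℕ) (s : Equiv.Perm (Fin (p + q))) : MonoidAlgebra K (GVB (p + q)) :=
  if IsShuffle p q s then
    (((List.Ico 1 (p + q)).reverse.filter fun k => bubbleIndex s k ≠ 0).map fun k =>
      (braidElt K (p + q) (bubbleIndex s k) +
        (if bubbleIndex s k + 1 = bubbleIndex s (k + 1) then 0 else
          braidRun K (p + q) 1 (bubbleIndex s k - 1) * virtElt K (p + q) (bubbleIndex s k))) *
      braidRun K (p + q) (bubbleIndex s k + 1) k).prod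
  else 0

open Classical in
/-- `M_{p,q}(s, τ)` in `n` strands, for `s ∈ 𝔖_n` and `τ ∈ GVB_n^+`: with `l = l_v(τ)`, it is the
lift `Q_{p-l,q}` of `s` on the positions `l + 1, …, p + q`, times `τ`, if `l < p` and `s` lies in
`𝔖_{p-l,q}^{↑l}`, and `0` otherwise. (The sum has at most one term, since `permArrow` is
injective.) -/
def liftStepMonoid (n p q : ℕ) (s : Equiv.Perm (Fin n)) (τ : GVB n) : MonoidAlgebra K (GVB n) :=
  if h : (virtLength n τ).toAdd < p ∧ p + q ≤ n then
    (∑ r : Equiv.Perm (Fin (p - (virtLength n τ).toAdd + q)),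
      if permArrow (n := n) (virtLength n τ).toAdd (by omega) r = s then
        MonoidAlgebra.mapDomainAlgHom K K (arrow (virtLength n τ).toAdd (by omega))
          (liftShuffle K (p - (virtLength n τ).toAdd) q r)
      else 0) * MonoidAlgebra.of K _ τ
  else 0

/-- `M_{p,q}(s, ·)`, extended linearly to `K[GVB_n^+]`. -/
def liftStep (n p q : ℕ) (s : Equiv.Perm (Fin n)) :
    MonoidAlgebra K (GVB n) →ₗ[K] MonoidAlgebra K (GVB n) :=
  Finsupp.linearCombination K (liftStepMonoid K n p q s) ∘ₗ
    (MonoidAlgebra.coeffLinearEquiv K).toLinearMap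

/-- `M_{k,1}(s^{(k)}, M_{k-1,1}(s^{(k-1)}, ⋯ M_{1,1}(s^{(1)}, e) ⋯ ))`. -/
def liftIter (n : ℕ) (s : Equiv.Perm (Fin n)) : ℕ → MonoidAlgebra K (GVB n)
  | 0 => 1
  | k + 1 => liftStep K n (k + 1) 1 (bubbleFactor s (k + 1)) (liftIter n s k)

/-- The generalized Matsumoto-Tits section `Q : 𝔖_n → K[GVB_n^+]`, the iterated lift along the
decomposition `𝔖_n ≃ 𝔖_{n-1,1} × ⋯ × 𝔖_{2,1} × 𝔖_{1,1}`. -/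
def lift (n : ℕ) (s : Equiv.Perm (Fin n)) : MonoidAlgebra K (GVB n) :=
  liftIter K n s (n - 1)

/-- The total symmetrization element `Q_n = ∑_{s ∈ 𝔖_n} Q(s)`. -/
def totalSymmElt (n : ℕ) : MonoidAlgebra K (GVB n) :=
  ∑ s : Equiv.Perm (Fin n), lift K n s

end Lifting

/-! ### Relations between the local operators -/

section LocalRelations

variable {K : Type u} [Field K] {V : Type v} [AddCommGroup V] [Module K V]

theorem onFirstTwo_comm (f : V ⊗[K] V →ₗ[K] V ⊗[K] V) {X Y : Type*} [AddCommGroup X]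
    [Module K X] [AddCommGroup Y] [Module K Y] (h : X →ₗ[K] Y) :
    onFirstTwo f Y ∘ₗ (h.lTensor V).lTensor V = (h.lTensor V).lTensor V ∘ₗ onFirstTwo f X := by
  ext a b x
  simp only [onFirstTwo, TensorProduct.AlgebraTensorModule.curry_apply,
    LinearMap.restrictScalars_self, TensorProduct.curry_apply, LinearMap.coe_comp,
    Function.comp_apply, LinearMap.lTensor_tmul, LinearEquiv.coe_coe,
    TensorProduct.assoc_symm_tmul, LinearMap.rTensor_tmul]
  generalize f (a ⊗ₜ[K] b) = t
  induction t with
  | zero => simp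
  | tmul p q => simp
  | add p q hp hq => simp only [TensorProduct.add_tmul, map_add, hp, hq]

theorem localOp_succ_succ (f : V ⊗[K] V →ₗ[K] V ⊗[K] V) (n i : ℕ) :
    localOp f (n + 2) (i + 2) =
      (split₂ n).symm.conj (((localOp f n i).lTensor V).lTensor V) := by
  refine LinearMap.ext fun x => ?_
  simp only [localOp, split₂, LinearEquiv.conj_apply_apply, LinearEquiv.trans_symm,
    LinearEquiv.trans_apply, LinearEquiv.symm_symm]
  congr 1
  generalize (consEquiv (n + 1)).symm x = y
  induction y with
  | zero => simp
  | tmul p q => simp [LinearEquiv.conj_apply_apply]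
  | add p q hp hq => simp only [map_add, hp, hq]

theorem localOp_far (f g : V ⊗[K] V →ₗ[K] V ⊗[K] V) (n i j : ℕ) (h : i + 2 ≤ j) :
    localOp f n i * localOp g n j = localOp g n j * localOp f n i := by
  induction n using Nat.strong_induction_on generalizing i j with
  | _ n ih =>
  match n, i, j, h with
  | 0, _, _, _ => simp [localOp]
  | 1, 0, _, _ => simp [localOp]
  | n + 2, 0, j + 2, _ =>
    rw [localOp_succ_succ, localOp, Module.End.mul_eq_comp, Module.End.mul_eq_comp,
      ← LinearEquiv.conj_comp, ← LinearEquiv.conj_comp, onFirstTwo_comm]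
  | n + 1, i + 1, j + 1, h =>
    have := ih n (by omega) i j (by omega)
    rw [Module.End.mul_eq_comp, Module.End.mul_eq_comp] at this
    rw [localOp, localOp, Module.End.mul_eq_comp, Module.End.mul_eq_comp,
      ← LinearEquiv.conj_comp, ← LinearEquiv.conj_comp, ← LinearMap.lTensor_comp,
      ← LinearMap.lTensor_comp, this]

/-- The isomorphism `V ⊗ (V ⊗ (V ⊗ V^{⊗n})) ≃ V^{⊗(n+3)}`. -/
def merge₃ (n : ℕ) : V ⊗[K] (V ⊗[K] (V ⊗[K] (⨂[K]^n V))) ≃ₗ[K] ⨂[K]^(n + 3) V :=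
  LinearEquiv.lTensor V (split₂ n).symm ≪≫ₗ consEquiv (n + 2)

theorem localOp_zero_eq (f : V ⊗[K] V →ₗ[K] V ⊗[K] V) (n : ℕ) :
    localOp f (n + 3) 0 = (merge₃ n).conj (onFirstTwo f (V ⊗[K] (⨂[K]^n V))) := by
  refine LinearMap.ext fun x => ?_
  obtain ⟨y, rfl⟩ := (merge₃ n).surjective x
  have h := LinearMap.congr_fun
    (onFirstTwo_comm f (consEquiv (K := K) (V := V) n).toLinearMap) y
  have e : ∀ z, (merge₃ (K := K) (V := V) n) z = (split₂ (n + 1)).symm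
      (((consEquiv n).toLinearMap.lTensor V).lTensor V z) := by
    intro z
    simp only [merge₃, split₂, LinearEquiv.trans_apply, LinearEquiv.trans_symm,
      LinearEquiv.symm_symm]
    congr 1
    induction z with
    | zero => simp
    | tmul p q =>
      simp only [LinearEquiv.lTensor_tmul, LinearMap.lTensor_tmul, LinearEquiv.trans_apply]
      rfl
    | add p q hp hq => simp only [map_add, hp, hq]
  simp only [LinearMap.coe_comp, Function.comp_apply] at h
  rw [LinearEquiv.conj_apply_apply, LinearEquiv.symm_apply_apply, e, e, localOp,
    LinearEquiv.conj_apply_apply, LinearEquiv.symm_symm, LinearEquiv.apply_symm_apply, h]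

theorem localOp_one_eq (f : V ⊗[K] V →ₗ[K] V ⊗[K] V) (n : ℕ) :
    localOp f (n + 3) 1 = (merge₃ n).conj ((onFirstTwo f (⨂[K]^n V)).lTensor V) := by
  refine LinearMap.ext fun x => ?_
  simp only [localOp, merge₃, LinearEquiv.conj_apply_apply, LinearEquiv.trans_symm,
    LinearEquiv.trans_apply]
  congr 1
  generalize (consEquiv (n + 2)).symm x = y
  induction y with
  | zero => simp
  | tmul p q => simp [LinearEquiv.conj_apply_apply]
  | add p q hp hq => simp only [map_add, hp, hq]

/-- The isomorphism `(V ⊗ (V ⊗ V)) ⊗ X ≃ V ⊗ (V ⊗ (V ⊗ X))`. -/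
def regroup (X : Type*) [AddCommGroup X] [Module K X] :
    (V ⊗[K] (V ⊗[K] V)) ⊗[K] X ≃ₗ[K] V ⊗[K] (V ⊗[K] (V ⊗[K] X)) :=
  TensorProduct.assoc K V (V ⊗[K] V) X ≪≫ₗ LinearEquiv.lTensor V (TensorProduct.assoc K V V X)

theorem onFirstTwo_regroup (f : V ⊗[K] V →ₗ[K] V ⊗[K] V) (X : Type*) [AddCommGroup X]
    [Module K X] :
    onFirstTwo f (V ⊗[K] X) = (regroup X).conj ((onFirstTwo f V).rTensor X) := by
  have : onFirstTwo f (V ⊗[K] X) ∘ₗ (regroup X).toLinearMap =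
      (regroup X).toLinearMap ∘ₗ (onFirstTwo f V).rTensor X := by
    ext a b c x
    simp [regroup, onFirstTwo]
    generalize f (a ⊗ₜ[K] b) = t
    induction t with
    | zero => simp
    | tmul p q => simp
    | add p q hp hq => simp only [TensorProduct.add_tmul, map_add, hp, hq]
  rw [LinearEquiv.conj_apply, LinearEquiv.eq_comp_toLinearMap_symm, this]

theorem lTensor_onFirstTwo_regroup (f : V ⊗[K] V →ₗ[K] V ⊗[K] V) (X : Type*) [AddCommGroup X]
    [Module K X] :
    (onFirstTwo f X).lTensor V = (regroup X).conj ((f.lTensor V).rTensor X) := by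
  have : (onFirstTwo f X).lTensor V ∘ₗ (regroup X).toLinearMap =
      (regroup X).toLinearMap ∘ₗ (f.lTensor V).rTensor X := by
    ext a b c x
    simp [regroup, onFirstTwo]
  rw [LinearEquiv.conj_apply, LinearEquiv.eq_comp_toLinearMap_symm, this]

theorem localOp_braid {a b c a' b' c' : V ⊗[K] V →ₗ[K] V ⊗[K] V}
    (h : onFirstTwo a V ∘ₗ b.lTensor V ∘ₗ onFirstTwo c V =
      a'.lTensor V ∘ₗ onFirstTwo b' V ∘ₗ c'.lTensor V) (n i : ℕ) :
    localOp a n i * localOp b n (i + 1) * localOp c n i =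
      localOp a' n (i + 1) * localOp b' n i * localOp c' n (i + 1) := by
  induction i generalizing n with
  | zero =>
    match n with
    | 0 => simp [localOp]
    | 1 => simp [localOp]
    | 2 => simp [localOp]
    | n + 3 =>
      simp only [localOp_zero_eq, localOp_one_eq, zero_add, onFirstTwo_regroup,
        lTensor_onFirstTwo_regroup, Module.End.mul_eq_comp, ← LinearEquiv.conj_comp,
        ← LinearMap.rTensor_comp, LinearMap.comp_assoc, h]
  | succ i ih =>
    match n with
    | 0 => simp [localOp]
    | n + 1 =>
      have := ih n
      simp only [localOp, Module.End.mul_eq_comp, ← LinearEquiv.conj_comp,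
        ← LinearMap.lTensor_comp] at this ⊢
      rw [this]

end LocalRelations

/-! ### The total symmetrization operator -/

/-- A braided algebra `(W, σ, m)` with a specified element `𝟏 ≠ 0` and a linear complement `V` of
`K 𝟏`, such that `𝟏` is a unit for `m` and is flipped by `σ`, and such that `σ` and `m` restrict
to a braided algebra structure on `V`. -/
structure UnitalBraidedAlgebra (K : Type u) [Field K] (W : Type v) [AddCommGroup W] [Module K W]
    extends BraidedAlgebra K W where
  /-- the specified element `𝟏` -/
  one : W
  one_ne_zero : one ≠ 0
  /-- the complement `V` of `K 𝟏` -/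
  V : Submodule K W
  isCompl : IsCompl (K ∙ one) V
  one_m : ∀ w, m (one ⊗ₜ w) = w
  m_one : ∀ w, m (w ⊗ₜ one) = w
  σ_one_left : ∀ w, σ (one ⊗ₜ w) = w ⊗ₜ one
  σ_one_right : ∀ w, σ (w ⊗ₜ one) = one ⊗ₜ w
  /-- the restricted braided algebra `(V, σ, m)` -/
  restr : BraidedAlgebra K V
  restr_σ : TensorProduct.map V.subtype V.subtype ∘ₗ restr.σ =
    σ ∘ₗ TensorProduct.map V.subtype V.subtype
  restr_m : V.subtype ∘ₗ restr.m = m ∘ₗ TensorProduct.map V.subtype V.subtype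

namespace UnitalBraidedAlgebra

variable {K : Type u} [Field K] {W : Type v} [AddCommGroup W] [Module K W]
variable (B : UnitalBraidedAlgebra K W)

/-- The map `σ^m (v ⊗ w) = 𝟏 ⊗ m(v ⊗ w)`. -/
def σm : W ⊗[K] W →ₗ[K] W ⊗[K] W :=
  TensorProduct.mk K W W B.one ∘ₗ B.m

theorem σm_tmul (x y : W) : B.σm (x ⊗ₜ y) = B.one ⊗ₜ B.m (x ⊗ₜ y) := rfl

theorem rel_vvv : onFirstTwo B.σm W ∘ₗ B.σm.lTensor W ∘ₗ onFirstTwo B.σm W =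
    B.σm.lTensor W ∘ₗ onFirstTwo B.σm W ∘ₗ B.σm.lTensor W := by
  ext a b c
  have := LinearMap.congr_fun B.m_assoc ((a ⊗ₜ b) ⊗ₜ c)
  simp only [LinearMap.coe_comp, Function.comp_apply, LinearMap.rTensor_tmul,
    LinearEquiv.coe_coe, TensorProduct.assoc_tmul, LinearMap.lTensor_tmul] at this
  simp [onFirstTwo, σm_tmul, B.one_m, B.m_one, this]

theorem rel_vbb : onFirstTwo B.σm W ∘ₗ B.σ.lTensor W ∘ₗ onFirstTwo B.σ W =
    B.σ.lTensor W ∘ₗ onFirstTwo B.σ W ∘ₗ B.σm.lTensor W := by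
  have key : ∀ X : W ⊗[K] (W ⊗[K] W), onFirstTwo B.σm W X =
      B.one ⊗ₜ (B.m.rTensor W ((TensorProduct.assoc K W W W).symm X)) := by
    intro X
    generalize hY : (TensorProduct.assoc K W W W).symm X = Y
    obtain rfl : X = TensorProduct.assoc K W W W Y := by simp [← hY]
    have : onFirstTwo B.σm W ∘ₗ (TensorProduct.assoc K W W W).toLinearMap =
        TensorProduct.mk K W (W ⊗[K] W) B.one ∘ₗ B.m.rTensor W := by
      ext a b c
      simp [onFirstTwo, σm_tmul]
    exact LinearMap.congr_fun this Y
  ext a b c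
  have h := LinearMap.congr_fun B.σ_m_right (a ⊗ₜ (b ⊗ₜ c))
  simp only [LinearMap.coe_comp, Function.comp_apply, LinearMap.lTensor_tmul,
    LinearEquiv.coe_coe] at h
  simp only [TensorProduct.AlgebraTensorModule.curry_apply, LinearMap.restrictScalars_self,
    TensorProduct.curry_apply, LinearMap.coe_comp, Function.comp_apply, key, ← h]
  simp [onFirstTwo, σm_tmul, B.σ_one_right]

theorem rel_vbb' : onFirstTwo B.σ W ∘ₗ B.σ.lTensor W ∘ₗ onFirstTwo B.σm W =
    B.σm.lTensor W ∘ₗ onFirstTwo B.σ W ∘ₗ B.σ.lTensor W := by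
  have key : ∀ X : W ⊗[K] (W ⊗[K] W), B.σm.lTensor W X =
      onFirstTwo B.σ W (B.one ⊗ₜ (B.m.lTensor W X)) := by
    intro X
    have : B.σm.lTensor W = onFirstTwo B.σ W ∘ₗ TensorProduct.mk K W (W ⊗[K] W) B.one ∘ₗ
        B.m.lTensor W := by
      ext a b c
      simp [onFirstTwo, σm_tmul, B.σ_one_left]
    exact LinearMap.congr_fun this X
  ext a b c
  have h := LinearMap.congr_fun B.σ_m_left (a ⊗ₜ (b ⊗ₜ c))
  simp only [LinearMap.coe_comp, Function.comp_apply, LinearMap.rTensor_tmul,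
    LinearEquiv.coe_coe, TensorProduct.assoc_symm_tmul] at h
  simp only [TensorProduct.AlgebraTensorModule.curry_apply, LinearMap.restrictScalars_self,
    TensorProduct.curry_apply, LinearMap.coe_comp, Function.comp_apply, key, ← h]
  simp [onFirstTwo, σm_tmul]

/-- The operators by which the generators of `GVB_n^+` act on `W^{⊗n}`. -/
def actGen (n : ℕ) : GVBGen n → Module.End K (⨂[K]^n W)
  | .braid i _ => localOp B.σ n (i - 1)
  | .virt i _ => localOp B.σm n (i - 1)

/-- The representation of `GVB_n^+` on `W^{⊗n}`:
`σ_i ↦ id^{⊗(i-1)} ⊗ σ ⊗ id^{⊗(n-i-1)}`, `ξ_i ↦ id^{⊗(i-1)} ⊗ σ^m ⊗ id^{⊗(n-i-1)}`. -/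
def act (n : ℕ) : GVB n →* Module.End K (⨂[K]^n W) :=
  PresentedMonoid.lift (B.actGen n)
    (by
      have far : ∀ (f g : W ⊗[K] W →ₗ[K] W ⊗[K] W) (i j : ℕ), 1 ≤ i → 1 ≤ j →
          (i + 1 < j ∨ j + 1 < i) → localOp f n (i - 1) * localOp g n (j - 1) =
            localOp g n (j - 1) * localOp f n (i - 1) := by
        intro f g i j hi hj h
        rcases h with h | h
        · exact localOp_far f g n _ _ (by omega)
        · exact (localOp_far g f n _ _ (by omega)).symm
      have e : ∀ i, 1 ≤ i → i + 1 - 1 = (i - 1) + 1 := by intro i hi; omega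
      intro a b h
      cases h with
      | far_bb i j hi hj h =>
        simpa [actGen] using far B.σ B.σ i j hi.1 hj.1 h
      | far_bv i j hi hj h =>
        simpa [actGen] using far B.σ B.σm i j hi.1 hj.1 h
      | far_vv i j hi hj h =>
        simpa [actGen] using far B.σm B.σm i j hi.1 hj.1 h
      | bbb i h h' =>
        simp only [map_mul, FreeMonoid.lift_eval_of, actGen, e i h.1]
        exact localOp_braid B.braid_eq n _
      | vvv i h h' =>
        simp only [map_mul, FreeMonoid.lift_eval_of, actGen, e i h.1]
        exact localOp_braid B.rel_vvv n _
      | vbb i h h' =>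
        simp only [map_mul, FreeMonoid.lift_eval_of, actGen, e i h.1]
        exact localOp_braid B.rel_vbb n _
      | vbb' i h h' =>
        simp only [map_mul, FreeMonoid.lift_eval_of, actGen, e i h.1]
        exact (localOp_braid B.rel_vbb' n _).symm)

/-- The representation of `K[GVB_n^+]` on `W^{⊗n}`. -/
def actAlg (n : ℕ) : MonoidAlgebra K (GVB n) →ₐ[K] Module.End K (⨂[K]^n W) :=
  MonoidAlgebra.lift K _ _ (B.act n)

/-- The coefficient of `𝟏` along the decomposition `W = K 𝟏 ⊕ V`. -/
def coeffOne : W →ₗ[K] K :=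
  (LinearEquiv.toSpanNonzeroSingleton K W B.one B.one_ne_zero).symm.toLinearMap ∘ₗ
    Submodule.projectionOnto (K ∙ B.one) B.V B.isCompl

/-- The component in `V` along the decomposition `W = K 𝟏 ⊕ V`. -/
def projV : W →ₗ[K] B.V :=
  Submodule.projectionOnto B.V (K ∙ B.one) B.isCompl.symm

/-- The deleting operator `D : T(W) → T(V)`. It is multiplicative for the concatenation products
and satisfies `D(𝟏) = 1` and `D(v) = v` for `v ∈ V`; thus on a pure tensor whose factors are `𝟏`
or elements of `V`, it deletes all factors `𝟏`. -/
def deleting : TensorAlgebra K W →ₐ[K] TensorAlgebra K B.V :=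
  TensorAlgebra.lift K
    (Algebra.linearMap K (TensorAlgebra K B.V) ∘ₗ B.coeffOne + TensorAlgebra.ι K ∘ₗ B.projV)

theorem deleting_one : B.deleting (TensorAlgebra.ι K B.one) = 1 := by
  have h : B.one ∈ (K ∙ B.one) := Submodule.mem_span_singleton_self _
  have h1 : B.coeffOne B.one = 1 := by
    have := Submodule.projectionOnto_apply_left B.isCompl ⟨B.one, h⟩
    simp only [coeffOne, LinearMap.coe_comp, Function.comp_apply, LinearEquiv.coe_coe]
    rw [LinearEquiv.symm_apply_eq]
    ext
    simp [this]
  have h2 : B.projV B.one = 0 := by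
    simp [projV]
  simp [deleting, h1, h2]

theorem deleting_mem (v : B.V) :
    B.deleting (TensorAlgebra.ι K (v : W)) = TensorAlgebra.ι K v := by
  have h1 : B.coeffOne v = 0 := by
    simp [coeffOne]
  have h2 : B.projV v = v := by
    simp [projV]
  simp [deleting, h1, h2]

/-- The total symmetrization operator of degree `n`, `QS_n = D ∘ Q_n : V^{⊗n} → T(V)`. -/
def QSn (n : ℕ) : (⨂[K]^n B.V) →ₗ[K] TensorAlgebra K B.V :=
  B.deleting.toLinearMap ∘ₗ TensorPower.toTensorAlgebra ∘ₗ B.actAlg n (totalSymmElt K n) ∘ₗ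
    PiTensorProduct.map fun _ => B.V.subtype

/-- The total symmetrization operator `QS = ∑_n QS_n : T(V) → T(V)`. -/
def QS : TensorAlgebra K B.V →ₗ[K] TensorAlgebra K B.V :=
  DirectSum.toModule K ℕ (TensorAlgebra K B.V) B.QSn ∘ₗ TensorAlgebra.equivDirectSum.toLinearMap

end UnitalBraidedAlgebra

end QuasiShuffle

end

/-! The whole theorem rests on one identity: `QS` turns concatenation with a vector on the right
into the quasi-shuffle product with that vector, QS(x c) = QS(x) ∗ c (`QS_mul_ι`). Hence QS(v₁ ⋯ vₙ)
is the iterated product (⋯(v₁ ∗ v₂) ∗ ⋯) ∗ vₙ. Every subspace containing 1 and V and closed under ∗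
therefore contains the image of `QS`. Conversely, the image contains 1 and V, and it is closed under
∗ by induction on the second factor, because x ∗ (y ∗ c) = (x ∗ y) ∗ c. So associativity is needed
only when the third factor is a vector (`qsMul_assoc_ι`). That case follows from the recursion for ∗
and from the rule for braiding a vector past a product (`braidPast_qsMul`), which encodes the braid
equation and both compatibilities of σ with m.

For the identity itself, permutations are coded by their bubble indices. All codes occur exactly
once (`bijective_bubbleIndex`), so Q_n is obtained by n - 1 successive steps, each summing over one
index (`totalSymmElt_succ`). On elements of virtual length l a step is left multiplication by a sum
of two kinds of terms in the positions after l (`sum_liftStep_bubble`). The runs σ_{t+1} ⋯ σ_p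
insert the new vector at some place by braiding. The terms (σ_1 ⋯ σ_t) ξ_{t+1} (σ_{t+2} ⋯ σ_p) braid
it next to a letter, multiply the two, leave 𝟏 behind and carry this 𝟏 to the front. These are
exactly the ways in which a vector enters the product x ∗ c (`exists_qsMul_ι_eq`).

The number of 𝟏's in front thus always equals the virtual length, which is why the lifts are shifted
by l and act on a tensor over V. The invariant is recorded by `partialSymm`. At the end the deleting
operator erases the 𝟏's and leaves the iterated product. -/

noncomputable section

namespace QuasiShuffle

universe u v

/-! ### Braiding and merging the leading factors of V ⊗ (V ⊗ X) -/

section Contexts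

variable {K : Type u} [Field K] {V : Type v} [AddCommGroup V] [Module K V]

/-- `m ⊗ id : V ⊗ (V ⊗ X) → V ⊗ X`. -/
def mergeFirst (m : V ⊗[K] V →ₗ[K] V) (X : Type*) [AddCommGroup X] [Module K X] :
    V ⊗[K] (V ⊗[K] X) →ₗ[K] V ⊗[K] X :=
  m.rTensor X ∘ₗ (TensorProduct.assoc K V V X).symm.toLinearMap

theorem mergeFirst_tmul (m : V ⊗[K] V →ₗ[K] V) {X : Type*} [AddCommGroup X] [Module K X]
    (a b : V) (x : X) : mergeFirst m X (a ⊗ₜ (b ⊗ₜ x)) = m (a ⊗ₜ b) ⊗ₜ x := by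
  simp [mergeFirst]

theorem onFirstTwo_tmul (f : V ⊗[K] V →ₗ[K] V ⊗[K] V) {X : Type*} [AddCommGroup X] [Module K X]
    (a b : V) (x : X) :
    onFirstTwo f X (a ⊗ₜ (b ⊗ₜ x)) = TensorProduct.assoc K V V X (f (a ⊗ₜ b) ⊗ₜ x) := by
  simp [onFirstTwo]

theorem mergeFirst_comm (m : V ⊗[K] V →ₗ[K] V) {X Y : Type*} [AddCommGroup X]
    [Module K X] [AddCommGroup Y] [Module K Y] (h : X →ₗ[K] Y) :
    mergeFirst m Y ∘ₗ (h.lTensor V).lTensor V = h.lTensor V ∘ₗ mergeFirst m X := by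
  ext a b x
  simp [mergeFirst]

/-- Together with `lTensor_mergeFirst_regroup` this reduces identities on V ⊗ (V ⊗ (V ⊗ X)) to the
axioms on V ⊗ (V ⊗ V), with X as a spectator. -/
theorem mergeFirst_regroup (m : V ⊗[K] V →ₗ[K] V) (X : Type*) [AddCommGroup X] [Module K X] :
    mergeFirst m (V ⊗[K] X) ∘ₗ (regroup X).toLinearMap =
      (TensorProduct.assoc K V V X).toLinearMap ∘ₗ (mergeFirst m V).rTensor X := by
  ext a b c x
  simp [regroup, mergeFirst]

theorem lTensor_mergeFirst_regroup (m : V ⊗[K] V →ₗ[K] V) (X : Type*) [AddCommGroup X]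
    [Module K X] :
    (mergeFirst m X).lTensor V ∘ₗ (regroup X).toLinearMap =
      (TensorProduct.assoc K V V X).toLinearMap ∘ₗ (m.lTensor V).rTensor X := by
  ext a b c x
  simp [regroup, mergeFirst]

/-- An operator `r : V ⊗ M → M` is carried to an operator on `V ⊗ M` by braiding past the first
factor. -/
def twist (f : V ⊗[K] V →ₗ[K] V ⊗[K] V) {M : Type*} [AddCommGroup M] [Module K M]
    (r : V ⊗[K] M →ₗ[K] M) : V ⊗[K] (V ⊗[K] M) →ₗ[K] V ⊗[K] M :=
  r.lTensor V ∘ₗ onFirstTwo f M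

/-- The axiom σ(m ⊗ id) = (id ⊗ m)σ₁σ₂, tensored with X and regrouped. -/
theorem onFirstTwo_mergeFirst {f : V ⊗[K] V →ₗ[K] V ⊗[K] V} {m : V ⊗[K] V →ₗ[K] V}
    (h : f ∘ₗ m.rTensor V ∘ₗ (TensorProduct.assoc K V V V).symm.toLinearMap =
      m.lTensor V ∘ₗ onFirstTwo f V ∘ₗ f.lTensor V)
    (X : Type*) [AddCommGroup X] [Module K X] :
    onFirstTwo f X ∘ₗ mergeFirst m (V ⊗[K] X) =
      (mergeFirst m X).lTensor V ∘ₗ onFirstTwo f (V ⊗[K] X) ∘ₗ (onFirstTwo f X).lTensor V := by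
  rw [lTensor_onFirstTwo_regroup, onFirstTwo_regroup]
  have h' := congrArg (fun g => (TensorProduct.assoc K V V X).toLinearMap ∘ₗ g.rTensor X) h
  simp only [LinearMap.rTensor_comp] at h'
  refine LinearMap.ext fun y => ?_
  obtain ⟨z, rfl⟩ := (regroup X).surjective y
  have h1 := LinearMap.congr_fun (mergeFirst_regroup m X) z
  have h2 := LinearMap.congr_fun (lTensor_mergeFirst_regroup m X)
    ((onFirstTwo f V).rTensor X ((f.lTensor V).rTensor X z))
  have h3 := LinearMap.congr_fun h' z
  simp only [LinearMap.comp_apply, LinearEquiv.coe_coe, LinearEquiv.conj_apply_apply,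
    LinearEquiv.symm_apply_apply] at h1 h2 h3 ⊢
  rw [h1, h2, ← h3, onFirstTwo, mergeFirst]
  simp only [LinearMap.comp_apply, LinearEquiv.coe_coe, LinearMap.rTensor_comp,
    LinearEquiv.symm_apply_apply]

/-- The axiom σ(id ⊗ m) = (m ⊗ id)σ₂σ₁, tensored with X and regrouped. -/
theorem onFirstTwo_lTensor_mergeFirst {f : V ⊗[K] V →ₗ[K] V ⊗[K] V} {m : V ⊗[K] V →ₗ[K] V}
    (h : f ∘ₗ m.lTensor V = m.rTensor V ∘ₗ (TensorProduct.assoc K V V V).symm.toLinearMap ∘ₗ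
      f.lTensor V ∘ₗ onFirstTwo f V)
    (X : Type*) [AddCommGroup X] [Module K X] :
    onFirstTwo f X ∘ₗ (mergeFirst m X).lTensor V =
      mergeFirst m (V ⊗[K] X) ∘ₗ (onFirstTwo f X).lTensor V ∘ₗ onFirstTwo f (V ⊗[K] X) := by
  rw [lTensor_onFirstTwo_regroup, onFirstTwo_regroup]
  have h' := congrArg (fun g => (TensorProduct.assoc K V V X).toLinearMap ∘ₗ g.rTensor X) h
  simp only [LinearMap.rTensor_comp] at h'
  refine LinearMap.ext fun y => ?_
  obtain ⟨z, rfl⟩ := (regroup X).surjective y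
  have h1 := LinearMap.congr_fun (mergeFirst_regroup m X)
    ((f.lTensor V).rTensor X ((onFirstTwo f V).rTensor X z))
  have h2 := LinearMap.congr_fun (lTensor_mergeFirst_regroup m X) z
  have h3 := LinearMap.congr_fun h' z
  simp only [LinearMap.comp_apply, LinearEquiv.coe_coe, LinearEquiv.conj_apply_apply,
    LinearEquiv.symm_apply_apply] at h1 h2 h3 ⊢
  rw [h1, h2, onFirstTwo, mergeFirst]
  simp only [LinearMap.comp_apply, LinearEquiv.coe_coe, LinearMap.rTensor_comp,
    LinearEquiv.symm_apply_apply]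
  rw [h3]

theorem onFirstTwo_braid {f : V ⊗[K] V →ₗ[K] V ⊗[K] V}
    (h : onFirstTwo f V ∘ₗ f.lTensor V ∘ₗ onFirstTwo f V =
      f.lTensor V ∘ₗ onFirstTwo f V ∘ₗ f.lTensor V)
    (X : Type*) [AddCommGroup X] [Module K X] :
    onFirstTwo f (V ⊗[K] X) ∘ₗ (onFirstTwo f X).lTensor V ∘ₗ onFirstTwo f (V ⊗[K] X) =
      (onFirstTwo f X).lTensor V ∘ₗ onFirstTwo f (V ⊗[K] X) ∘ₗ (onFirstTwo f X).lTensor V := by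
  simp only [lTensor_onFirstTwo_regroup, onFirstTwo_regroup, ← LinearEquiv.conj_comp,
    ← LinearMap.rTensor_comp, h]

theorem mergeFirst_mergeFirst {m : V ⊗[K] V →ₗ[K] V}
    (h : m ∘ₗ m.rTensor V = m ∘ₗ m.lTensor V ∘ₗ (TensorProduct.assoc K V V V).toLinearMap)
    (X : Type*) [AddCommGroup X] [Module K X] :
    mergeFirst m X ∘ₗ mergeFirst m (V ⊗[K] X) = mergeFirst m X ∘ₗ (mergeFirst m X).lTensor V := by
  ext a b c x
  have := LinearMap.congr_fun h ((a ⊗ₜ b) ⊗ₜ c)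
  simp only [LinearMap.coe_comp, Function.comp_apply, LinearMap.rTensor_tmul,
    LinearEquiv.coe_coe, TensorProduct.assoc_tmul, LinearMap.lTensor_tmul] at this
  simp [mergeFirst, this]

theorem twist_lTensor (f : V ⊗[K] V →ₗ[K] V ⊗[K] V) {M N : Type*} [AddCommGroup M] [Module K M]
    [AddCommGroup N] [Module K N] {r : V ⊗[K] M →ₗ[K] M} {s : V ⊗[K] N →ₗ[K] N} {g : M →ₗ[K] N}
    (h : g ∘ₗ r = s ∘ₗ g.lTensor V) :
    g.lTensor V ∘ₗ twist f r = twist f s ∘ₗ (g.lTensor V).lTensor V := by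
  rw [twist, twist, LinearMap.comp_assoc, onFirstTwo_comm, ← LinearMap.comp_assoc,
    ← LinearMap.comp_assoc, ← LinearMap.lTensor_comp, ← LinearMap.lTensor_comp, h]

/-- Naturality puts both braidings before the use of `r`, so that identities between braidings can
be applied without knowing `r`. -/
theorem twist_twist (f : V ⊗[K] V →ₗ[K] V ⊗[K] V) {M : Type*} [AddCommGroup M] [Module K M]
    (r : V ⊗[K] M →ₗ[K] M) : twist f (twist f r) =
      (r.lTensor V).lTensor V ∘ₗ (onFirstTwo f M).lTensor V ∘ₗ onFirstTwo f (V ⊗[K] M) := by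
  simp only [twist, LinearMap.lTensor_comp, LinearMap.comp_assoc]

/-- By the braid equation, crossing two strands after a third has passed them is the same as
crossing them before. -/
theorem onFirstTwo_twist_twist {f : V ⊗[K] V →ₗ[K] V ⊗[K] V}
    (h : onFirstTwo f V ∘ₗ f.lTensor V ∘ₗ onFirstTwo f V =
      f.lTensor V ∘ₗ onFirstTwo f V ∘ₗ f.lTensor V)
    {M : Type*} [AddCommGroup M] [Module K M] (r : V ⊗[K] M →ₗ[K] M) :
    onFirstTwo f M ∘ₗ twist f (twist f r) =
      twist f (twist f r) ∘ₗ (onFirstTwo f M).lTensor V := by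
  rw [twist_twist, ← LinearMap.comp_assoc, onFirstTwo_comm]
  simp only [LinearMap.comp_assoc]
  rw [onFirstTwo_braid h]

/-- Passing a letter by two vectors and then multiplying these agrees with multiplying first, by
σ(id ⊗ m) = (m ⊗ id)σ₂σ₁. -/
theorem mergeFirst_twist_twist {f : V ⊗[K] V →ₗ[K] V ⊗[K] V} {m : V ⊗[K] V →ₗ[K] V}
    (h : f ∘ₗ m.lTensor V = m.rTensor V ∘ₗ (TensorProduct.assoc K V V V).symm.toLinearMap ∘ₗ
      f.lTensor V ∘ₗ onFirstTwo f V)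
    {M : Type*} [AddCommGroup M] [Module K M] (r : V ⊗[K] M →ₗ[K] M) :
    mergeFirst m M ∘ₗ twist f (twist f r) = twist f r ∘ₗ (mergeFirst m M).lTensor V := by
  rw [twist_twist, ← LinearMap.comp_assoc, mergeFirst_comm, twist, LinearMap.comp_assoc,
    LinearMap.comp_assoc, onFirstTwo_lTensor_mergeFirst h]

end Contexts

/-! ### Braiding vectors past a tensor -/

namespace BraidedAlgebra

variable {K : Type u} [Field K] {V : Type v} [AddCommGroup V] [Module K V]
variable (A : BraidedAlgebra K V)

local notation "T" => TensorAlgebra K V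

@[simp] theorem prepend_tmul (a : V) (x : T) :
    prepend (K := K) (a ⊗ₜ x) = TensorAlgebra.ι K a * x := by
  simp [prepend]

theorem tensorAlgebra_induction_left {p : T → Prop} (one : p 1)
    (add : ∀ x y, p x → p y → p (x + y)) (smul : ∀ (c : K) x, p x → p (c • x))
    (ι_mul : ∀ a x, p x → p (TensorAlgebra.ι K a * x)) (x : T) : p x := by
  -- The algebra induction has a product case, which closes only for the stronger claim that left
  -- multiplication by x preserves `p`.
  have key : ∀ x y : T, p y → p (x * y) := by
    intro x
    induction x using TensorAlgebra.induction with
    | algebraMap r => intro y hy; rw [← Algebra.smul_def]; exact smul r y hy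
    | ι a => exact ι_mul a
    | mul x x' hx hx' => intro y hy; rw [mul_assoc]; exact hx _ (hx' _ hy)
    | add x x' hx hx' => intro y hy; rw [add_mul]; exact add _ _ (hx _ hy) (hx' _ hy)
  simpa using key x 1 one

theorem tensorAlgebra_induction_right {p : T → Prop} (one : p 1)
    (add : ∀ x y, p x → p y → p (x + y)) (smul : ∀ (c : K) x, p x → p (c • x))
    (mul_ι : ∀ x a, p x → p (x * TensorAlgebra.ι K a)) (x : T) : p x := by
  have key : ∀ x y : T, p y → p (y * x) := by
    intro x
    induction x using TensorAlgebra.induction with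
    | algebraMap r => intro y hy; rw [← Algebra.commutes, ← Algebra.smul_def]; exact smul r y hy
    | ι a => exact fun y => mul_ι y a
    | mul x x' hx hx' => intro y hy; rw [← mul_assoc]; exact hx' _ (hx _ hy)
    | add x x' hx hx' => intro y hy; rw [mul_add]; exact add _ _ (hx _ hy) (hx' _ hy)
  simpa using key x 1 one

/-- A map on `T(V)` that intertwines prepending with `r` is determined by its value at `1`. -/
theorem equivariant_ext {M : Type*} [AddCommGroup M] [Module K M] {r : V ⊗[K] M →ₗ[K] M}
    {f g : T →ₗ[K] M} (hf : f ∘ₗ prepend = r ∘ₗ f.lTensor V)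
    (hg : g ∘ₗ prepend = r ∘ₗ g.lTensor V) (h1 : f 1 = g 1) : f = g := by
  refine LinearMap.ext fun x => ?_
  induction x using tensorAlgebra_induction_left with
  | one => exact h1
  | add x y hx hy => rw [map_add, map_add, hx, hy]
  | smul c x hx => rw [map_smul, map_smul, hx]
  | ι_mul a x hx =>
    have h1 := LinearMap.congr_fun hf (a ⊗ₜ x)
    have h2 := LinearMap.congr_fun hg (a ⊗ₜ x)
    simp only [LinearMap.comp_apply, prepend_tmul, LinearMap.lTensor_tmul] at h1 h2
    rw [h1, h2, hx]

/-- The braiding `T(V) ⊗ V → V ⊗ T(V)` of a tensor past a vector `c`. -/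
def braidPast : V →ₗ[K] T →ₗ[K] V ⊗[K] T :=
  -- Letting a act by `twist (a ⊗ ·)` makes V ⊗ T(V) a left T(V)-module; the braiding of c past x is
  -- the action of x on c ⊗ 1.
  LinearMap.flip
    ((LinearMap.lcomp K (V ⊗[K] T) ((TensorProduct.mk K V T).flip 1)) ∘ₗ
      (TensorAlgebra.lift K (TensorProduct.curry (twist A.σ prepend) :
        V →ₗ[K] Module.End K (V ⊗[K] T))).toLinearMap)

theorem braidPast_one (c : V) : A.braidPast c 1 = c ⊗ₜ 1 := by
  simp [braidPast]

theorem braidPast_ι_mul (c a : V) (x : T) : A.braidPast c (TensorAlgebra.ι K a * x) =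
    twist A.σ prepend (a ⊗ₜ A.braidPast c x) := by
  simp [braidPast]

theorem braidPast_prepend (c : V) :
    A.braidPast c ∘ₗ prepend = twist A.σ prepend ∘ₗ (A.braidPast c).lTensor V := by
  refine TensorProduct.ext' fun a x => ?_
  simp [braidPast_ι_mul]

/-- The braiding `T(V) ⊗ V ⊗ V → V ⊗ V ⊗ T(V)`. -/
def braidPast₂ : V ⊗[K] V →ₗ[K] T →ₗ[K] V ⊗[K] (V ⊗[K] T) :=
  TensorProduct.lift (LinearMap.mk₂ K (fun b c => (A.braidPast c).lTensor V ∘ₗ A.braidPast b)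
    (by intro b b' c; simp [LinearMap.comp_add])
    (by intro k b c; simp [LinearMap.comp_smul])
    (by intro b c c'; simp [LinearMap.lTensor_add, LinearMap.add_comp])
    (by intro k b c; simp [LinearMap.lTensor_smul, LinearMap.smul_comp]))

theorem braidPast₂_tmul (b c : V) :
    A.braidPast₂ (b ⊗ₜ c) = (A.braidPast c).lTensor V ∘ₗ A.braidPast b := rfl

theorem braidPast₂_one (t : V ⊗[K] V) :
    A.braidPast₂ t 1 = TensorProduct.assoc K V V T (t ⊗ₜ 1) := by
  induction t with
  | zero => simp
  | tmul b c => simp [braidPast₂_tmul, braidPast_one]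
  | add s t hs ht => rw [map_add, LinearMap.add_apply, hs, ht, TensorProduct.add_tmul, map_add]

theorem braidPast₂_prepend (t : V ⊗[K] V) : A.braidPast₂ t ∘ₗ prepend =
    twist A.σ (twist A.σ prepend) ∘ₗ (A.braidPast₂ t).lTensor V := by
  induction t with
  | zero => simp
  | tmul b c =>
    rw [braidPast₂_tmul, LinearMap.comp_assoc, braidPast_prepend, ← LinearMap.comp_assoc,
      twist_lTensor A.σ (A.braidPast_prepend c), LinearMap.lTensor_comp, LinearMap.comp_assoc]
  | add s t hs ht =>
    rw [map_add, LinearMap.add_comp, hs, ht, LinearMap.lTensor_add, LinearMap.comp_add]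

/-- Both sides intertwine prepending with the doubly twisted operator, the left side by the braid
equation, so it suffices to compare them at 1. -/
theorem onFirstTwo_braidPast₂ (t : V ⊗[K] V) :
    onFirstTwo A.σ T ∘ₗ A.braidPast₂ t = A.braidPast₂ (A.σ t) := by
  refine equivariant_ext (r := twist A.σ (twist A.σ prepend)) ?_ (A.braidPast₂_prepend _) ?_
  · rw [LinearMap.comp_assoc, braidPast₂_prepend, ← LinearMap.comp_assoc,
      onFirstTwo_twist_twist A.braid_eq, LinearMap.lTensor_comp, LinearMap.comp_assoc]
  · simp [braidPast₂_one, onFirstTwo]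

/-- Again both sides are equivariant, now by the compatibility of σ with m on the right, and they
agree at 1. -/
theorem mergeFirst_braidPast₂ (t : V ⊗[K] V) :
    mergeFirst A.m T ∘ₗ A.braidPast₂ t = A.braidPast (A.m t) := by
  refine equivariant_ext (r := twist A.σ prepend) ?_ (A.braidPast_prepend _) ?_
  · rw [LinearMap.comp_assoc, braidPast₂_prepend, ← LinearMap.comp_assoc,
      mergeFirst_twist_twist A.σ_m_right, LinearMap.lTensor_comp, LinearMap.comp_assoc]
  · simp [braidPast₂_one, braidPast_one, mergeFirst]

end BraidedAlgebra

/-! ### Homogeneous elements of the tensor algebra -/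

section TensorPowers

variable {K : Type u} [Field K] {V : Type v} [AddCommGroup V] [Module K V]

theorem toTensorAlgebra_cons (n : ℕ) (a : V) (x : ⨂[K]^n V) :
    TensorPower.toTensorAlgebra (cons n (a ⊗ₜ x)) =
      TensorAlgebra.ι K a * TensorPower.toTensorAlgebra x := by
  induction x using PiTensorProduct.induction_on with
  | smul_tprod r f =>
    simp [cons_tmul_tprod, TensorAlgebra.tprod_apply, List.ofFn_succ]
  | add x y hx hy => simp only [TensorProduct.tmul_add, map_add, hx, hy, mul_add]

theorem toTensorAlgebra_consEquiv (n : ℕ) (a : V) (x : ⨂[K]^n V) :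
    TensorPower.toTensorAlgebra (consEquiv n (a ⊗ₜ x)) =
      TensorAlgebra.ι K a * TensorPower.toTensorAlgebra x :=
  toTensorAlgebra_cons n a x

theorem equivDirectSum_toTensorAlgebra (n : ℕ) (x : ⨂[K]^n V) :
    TensorAlgebra.equivDirectSum (R := K) (TensorPower.toTensorAlgebra x) =
      DirectSum.lof K ℕ (fun n => ⨂[K]^n V) n x := by
  induction x using PiTensorProduct.induction_on with
  | smul_tprod r f =>
    rw [map_smul, map_smul, map_smul, TensorPower.toTensorAlgebra_tprod,
      TensorAlgebra.equivDirectSum_apply, TensorAlgebra.toDirectSum_tensorPower_tprod]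
    rfl
  | add x y hx hy => simp only [map_add, hx, hy]

/-- A linear property of tensors can be checked on homogeneous ones. -/
theorem tensorAlgebra_induction_homogeneous {p : TensorAlgebra K V → Prop}
    (add : ∀ x y, p x → p y → p (x + y))
    (homogeneous : ∀ n (x : ⨂[K]^n V), p (TensorPower.toTensorAlgebra x))
    (x : TensorAlgebra K V) : p x := by
  obtain ⟨y, rfl⟩ := (TensorAlgebra.equivDirectSum (R := K) (M := V)).symm.surjective x
  induction y using DirectSum.induction_on with
  | zero => simpa using homogeneous 0 0
  | of n z =>
    have := equivDirectSum_toTensorAlgebra (K := K) n z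
    rw [DirectSum.lof_eq_of] at this
    rw [← this, AlgEquiv.symm_apply_apply]
    exact homogeneous n z
  | add x y hx hy => rw [map_add]; exact add _ _ hx hy

theorem toTensorAlgebra_zero_eq (x : ⨂[K]^0 V) :
    ∃ r : K, TensorPower.toTensorAlgebra x = algebraMap K (TensorAlgebra K V) r := by
  induction x using PiTensorProduct.induction_on with
  | smul_tprod r f => exact ⟨r, by simp [TensorAlgebra.tprod_apply, Algebra.algebraMap_eq_smul_one]⟩
  | add x y hx hy =>
    obtain ⟨r, hr⟩ := hx
    obtain ⟨s, hs⟩ := hy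
    exact ⟨r + s, by rw [map_add, map_add, hr, hs]⟩

end TensorPowers

/-! ### The quasi-shuffle product on T(V): recursion, braiding and associativity -/

namespace BraidedAlgebra

variable {K : Type u} [Field K] {V : Type v} [AddCommGroup V] [Module K V]
variable (A : BraidedAlgebra K V)

local notation "T" => TensorAlgebra K V

theorem qsMul_toTensorAlgebra (i j : ℕ) (x : ⨂[K]^i V) (y : ⨂[K]^j V) :
    A.qsMul (TensorPower.toTensorAlgebra x) (TensorPower.toTensorAlgebra y) =
      A.qsPart i j (x ⊗ₜ y) := by
  have h1 := equivDirectSum_toTensorAlgebra (K := K) i x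
  have h2 := equivDirectSum_toTensorAlgebra (K := K) j y
  simp only [qsMul, LinearMap.compl₁₂_apply, AlgEquiv.toLinearMap_apply, h1, h2]
  erw [DirectSum.toModule_lof]
  rw [LinearMap.flip_apply]
  erw [DirectSum.toModule_lof]
  rfl

theorem qsMul_one_left (y : T) : A.qsMul 1 y = y := by
  induction y using tensorAlgebra_induction_homogeneous with
  | add x y hx hy => rw [map_add, hx, hy]
  | homogeneous n y =>
    have : (1 : T) = TensorPower.toTensorAlgebra
        (PiTensorProduct.tprod K (Fin.elim0 : Fin 0 → V)) := by
      simp [TensorAlgebra.tprod_apply]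
    conv_lhs => rw [this, qsMul_toTensorAlgebra, qsPart]
    simp [TensorAlgebra.tprod_apply]

theorem qsMul_one_right (x : T) : A.qsMul x 1 = x := by
  induction x using tensorAlgebra_induction_homogeneous with
  | add x y hx hy => rw [map_add, LinearMap.add_apply, hx, hy]
  | homogeneous n x =>
    have : (1 : T) = TensorPower.toTensorAlgebra
        (PiTensorProduct.tprod K (Fin.elim0 : Fin 0 → V)) := by
      simp [TensorAlgebra.tprod_apply]
    conv_lhs => rw [this, qsMul_toTensorAlgebra]
    cases n <;> simp [qsPart, TensorAlgebra.tprod_apply]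

/-- Identifies the degreewise braidings β_{i,1} of the definition with the single map `braidPast c`
on T(V). -/
theorem lTensor_toTensorAlgebra_β (i : ℕ) (x : ⨂[K]^i V) (c : V) :
    TensorPower.toTensorAlgebra.lTensor V (A.β i (x ⊗ₜ c)) =
      A.braidPast c (TensorPower.toTensorAlgebra x) := by
  induction i with
  | zero =>
    obtain ⟨r, hr⟩ := toTensorAlgebra_zero_eq x
    simp [β, hr, Algebra.algebraMap_eq_smul_one, braidPast_one]
  | succ i ih =>
    obtain ⟨y, rfl⟩ := (consEquiv i).surjective x
    induction y with
    | zero => simp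
    | add y z hy hz => simp only [map_add, TensorProduct.add_tmul, hy, hz]
    | tmul a x =>
      rw [toTensorAlgebra_consEquiv, braidPast_ι_mul, ← ih]
      simp only [β, LinearMap.comp_apply, LinearEquiv.coe_coe, LinearMap.rTensor_tmul,
        LinearEquiv.symm_apply_apply, TensorProduct.assoc_tmul, LinearMap.lTensor_tmul]
      generalize A.β i (x ⊗ₜ c) = t
      induction t with
      | zero => simp
      | add s t hs ht => simp only [TensorProduct.tmul_add, map_add, hs, ht]
      | tmul d x =>
        simp only [TensorProduct.assoc_symm_tmul, LinearMap.rTensor_tmul, LinearMap.lTensor_tmul,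
          twist, LinearMap.comp_apply, onFirstTwo_tmul]
        generalize A.σ (a ⊗ₜ d) = s
        induction s with
        | zero => simp
        | add s t hs ht => simp only [TensorProduct.add_tmul, map_add, hs, ht]
        | tmul p q => simp [toTensorAlgebra_consEquiv]

theorem lTensor_qsPart (i j : ℕ) (t : V ⊗[K] (⨂[K]^i V)) (y : ⨂[K]^j V) :
    (A.qsPart i j).lTensor V (TensorProduct.assoc K V _ _ (t ⊗ₜ y)) =
      (A.qsMul.flip (TensorPower.toTensorAlgebra y)).lTensor V
        (TensorPower.toTensorAlgebra.lTensor V t) := by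
  induction t with
  | zero => simp
  | add s t hs ht => simp only [TensorProduct.add_tmul, map_add, hs, ht]
  | tmul a x => simp [qsMul_toTensorAlgebra]

/-- The defining recursion, freed from degrees. The three terms are sorted by their first letter: a
itself, b braided past a x, or the product of a with b braided past x. -/
theorem qsMul_ι_mul_ι_mul (a b : V) (x y : T) :
    A.qsMul (TensorAlgebra.ι K a * x) (TensorAlgebra.ι K b * y) =
      TensorAlgebra.ι K a * A.qsMul x (TensorAlgebra.ι K b * y) +
      prepend ((A.qsMul.flip y).lTensor V (A.braidPast b (TensorAlgebra.ι K a * x))) +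
      prepend (mergeFirst A.m T (a ⊗ₜ (A.qsMul.flip y).lTensor V (A.braidPast b x))) := by
  induction x using tensorAlgebra_induction_homogeneous with
  | add x x' hx hx' =>
    simp only [mul_add, map_add, LinearMap.add_apply, TensorProduct.tmul_add, hx, hx']
    abel
  | homogeneous i x =>
    induction y using tensorAlgebra_induction_homogeneous with
    | add y y' hy hy' =>
      simp only [mul_add, map_add, LinearMap.add_apply, TensorProduct.tmul_add, hy, hy',
        LinearMap.lTensor_add]
      abel
    | homogeneous j y =>
      rw [← toTensorAlgebra_consEquiv, ← toTensorAlgebra_consEquiv, qsMul_toTensorAlgebra,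
        qsMul_toTensorAlgebra, ← lTensor_toTensorAlgebra_β, ← lTensor_toTensorAlgebra_β,
        ← lTensor_qsPart, ← lTensor_qsPart, qsPart]
      simp only [LinearMap.add_apply, LinearMap.comp_apply, LinearEquiv.coe_coe,
        LinearMap.rTensor_tmul, LinearMap.lTensor_tmul, LinearEquiv.symm_apply_apply,
        TensorProduct.assoc_tmul, prepend_tmul, TensorProduct.assoc_symm_tmul,
        TensorProduct.map_tmul]
      congr 2
      generalize A.β i (x ⊗ₜ b) = t
      induction t with
      | zero => simp
      | add s t hs ht => simp only [TensorProduct.add_tmul, TensorProduct.tmul_add, map_add, hs, ht]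
      | tmul d z => simp [mergeFirst_tmul]

/-- The product `x ∗ (c ⊗ y)` without the terms starting with a factor of `x`:
`c ⊗ y ↦ (id ⊗ (· ∗ y)) (x c)`, where `c` is braided past `x`. -/
def braidMul : T →ₗ[K] V ⊗[K] T →ₗ[K] V ⊗[K] T :=
  LinearMap.flip (TensorProduct.lift (LinearMap.mk₂ K
    (fun c y => (A.qsMul.flip y).lTensor V ∘ₗ A.braidPast c)
    (by intro b b' c; simp [LinearMap.comp_add])
    (by intro k b c; simp [LinearMap.comp_smul])
    (by intro b c c'; simp [LinearMap.lTensor_add, LinearMap.add_comp])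
    (by intro k b c; simp [LinearMap.lTensor_smul, LinearMap.smul_comp])))

theorem braidMul_tmul (x : T) (c : V) (y : T) :
    A.braidMul x (c ⊗ₜ y) = (A.qsMul.flip y).lTensor V (A.braidPast c x) := rfl

theorem braidMul_one (t : V ⊗[K] T) : A.braidMul 1 t = t := by
  induction t with
  | zero => simp
  | add s t hs ht => rw [map_add, hs, ht]
  | tmul c y => simp [braidMul_tmul, braidPast_one, qsMul_one_left]

theorem braidMul_tmul_one (x : T) (c : V) : A.braidMul x (c ⊗ₜ 1) = A.braidPast c x := by
  have : A.qsMul.flip 1 = LinearMap.id := LinearMap.ext fun x => by simp [qsMul_one_right]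
  rw [braidMul_tmul, this, LinearMap.lTensor_id, LinearMap.id_apply]

theorem qsMul_ι_mul_prepend (a : V) (x : T) (t : V ⊗[K] T) :
    A.qsMul (TensorAlgebra.ι K a * x) (prepend t) =
      TensorAlgebra.ι K a * A.qsMul x (prepend t) +
      prepend (A.braidMul (TensorAlgebra.ι K a * x) t) +
      prepend (mergeFirst A.m T (a ⊗ₜ A.braidMul x t)) := by
  induction t with
  | zero => simp
  | add s t hs ht =>
    simp only [mul_add, map_add, TensorProduct.tmul_add, hs, ht]
    abel
  | tmul c y => rw [prepend_tmul, qsMul_ι_mul_ι_mul, braidMul_tmul, braidMul_tmul]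

/-- `b ⊗ x ↦ b ⊗ braidMul x t`. -/
def braidMulRight (t : V ⊗[K] T) : V ⊗[K] T →ₗ[K] V ⊗[K] (V ⊗[K] T) :=
  (A.braidMul.flip t).lTensor V

/-- Braiding b and then c past x yields both vectors in front; in this form `onFirstTwo_braidPast₂`
and `mergeFirst_braidPast₂` become applicable. -/
theorem braidMulRight_tmul_braidPast (b c : V) (u x : T) :
    A.braidMulRight (c ⊗ₜ u) (A.braidPast b x) =
      ((A.qsMul.flip u).lTensor V).lTensor V (A.braidPast₂ (b ⊗ₜ c) x) := by
  rw [braidPast₂_tmul, LinearMap.comp_apply, ← LinearMap.lTensor_comp_apply]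
  rfl

theorem braidMulRight_add (s t : V ⊗[K] T) :
    A.braidMulRight (s + t) = A.braidMulRight s + A.braidMulRight t := by
  rw [braidMulRight, map_add, LinearMap.lTensor_add]
  rfl

/-- The product formula for `(a w) ∗ (b' u)`, applied to the second factor of `twist (a ⊗ t)`. -/
theorem lTensor_qsMul_twist (a b : V) (u : T) (t : V ⊗[K] T) :
    (A.qsMul.flip (TensorAlgebra.ι K b * u)).lTensor V (twist A.σ prepend (a ⊗ₜ t)) =
      twist A.σ prepend (a ⊗ₜ (A.qsMul.flip (TensorAlgebra.ι K b * u)).lTensor V t) +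
      prepend.lTensor V (((A.qsMul.flip u).lTensor V).lTensor V
        ((A.braidPast b).lTensor V (twist A.σ prepend (a ⊗ₜ t)))) +
      prepend.lTensor V ((mergeFirst A.m T).lTensor V (onFirstTwo A.σ (V ⊗[K] T)
        (a ⊗ₜ ((A.qsMul.flip u).lTensor V).lTensor V ((A.braidPast b).lTensor V t)))) := by
  induction t with
  | zero => simp
  | add s t hs ht =>
    simp only [map_add, TensorProduct.tmul_add, hs, ht]
    abel
  | tmul c w =>
    simp only [twist, LinearMap.comp_apply, LinearMap.lTensor_tmul, onFirstTwo_tmul]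
    generalize A.σ (a ⊗ₜ c) = s
    induction s with
    | zero => simp
    | add s t hs ht =>
      simp only [map_add, TensorProduct.add_tmul, hs, ht]
      abel
    | tmul p q =>
      simp only [TensorProduct.assoc_tmul, LinearMap.lTensor_tmul, prepend_tmul,
        LinearMap.flip_apply, qsMul_ι_mul_ι_mul, TensorProduct.tmul_add]

/-- The recursion for a product with first factor a x, carried through the braiding. The second and
third terms are brought to a common shape by the braid equation, the third also by σ(m ⊗ id) = (id ⊗
m)σ₁σ₂. -/
theorem braidMul_twist_tmul (a b c : V) (x u : T) :
    A.braidMul (TensorAlgebra.ι K a * x) (twist A.σ prepend (b ⊗ₜ (c ⊗ₜ u))) =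
      twist A.σ prepend (a ⊗ₜ A.braidMul x (twist A.σ prepend (b ⊗ₜ (c ⊗ₜ u)))) +
      twist A.σ prepend (A.braidMulRight (c ⊗ₜ u) (A.braidPast b (TensorAlgebra.ι K a * x))) +
      twist A.σ prepend (mergeFirst A.m (V ⊗[K] T)
        (a ⊗ₜ A.braidMulRight (c ⊗ₜ u) (A.braidPast b x))) := by
  have comm : ∀ z, onFirstTwo A.σ T (((A.qsMul.flip u).lTensor V).lTensor V z) =
      ((A.qsMul.flip u).lTensor V).lTensor V (onFirstTwo A.σ T z) :=
    LinearMap.congr_fun (onFirstTwo_comm A.σ (A.qsMul.flip u))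
  have key : ∀ x, onFirstTwo A.σ T (A.braidPast₂ (b ⊗ₜ c) x) =
      A.braidPast₂ (A.σ (b ⊗ₜ c)) x :=
    LinearMap.congr_fun (A.onFirstTwo_braidPast₂ (b ⊗ₜ c))
  have hm : ∀ z, onFirstTwo A.σ T (mergeFirst A.m (V ⊗[K] T) z) =
      (mergeFirst A.m T).lTensor V (onFirstTwo A.σ (V ⊗[K] T) ((onFirstTwo A.σ T).lTensor V z)) :=
    LinearMap.congr_fun (onFirstTwo_mergeFirst A.σ_m_left T)
  have h2 : twist A.σ prepend (A.braidMulRight (c ⊗ₜ u)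
      (A.braidPast b (TensorAlgebra.ι K a * x))) = prepend.lTensor V
      (((A.qsMul.flip u).lTensor V).lTensor V
        (A.braidPast₂ (A.σ (b ⊗ₜ c)) (TensorAlgebra.ι K a * x))) := by
    rw [braidMulRight_tmul_braidPast, twist, LinearMap.comp_apply, comm, key]
  have h3 : twist A.σ prepend (mergeFirst A.m (V ⊗[K] T)
      (a ⊗ₜ A.braidMulRight (c ⊗ₜ u) (A.braidPast b x))) = prepend.lTensor V
      ((mergeFirst A.m T).lTensor V (onFirstTwo A.σ (V ⊗[K] T)
        (a ⊗ₜ ((A.qsMul.flip u).lTensor V).lTensor V (A.braidPast₂ (A.σ (b ⊗ₜ c)) x)))) := by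
    rw [braidMulRight_tmul_braidPast, twist, LinearMap.comp_apply, hm, LinearMap.lTensor_tmul,
      comm, key]
  have h0 : twist A.σ prepend (b ⊗ₜ (c ⊗ₜ u)) =
      prepend.lTensor V (TensorProduct.assoc K V V T (A.σ (b ⊗ₜ c) ⊗ₜ u)) := by
    rw [twist, LinearMap.comp_apply, onFirstTwo_tmul]
  rw [h2, h3, h0]
  -- Both sides now depend on b and c only through σ(b ⊗ c), linearly, so this may be replaced by a
  -- pure tensor p ⊗ q.
  generalize A.σ (b ⊗ₜ c) = s
  induction s with
  | zero => simp
  | add s t hs ht =>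
    simp only [map_add, LinearMap.add_apply, TensorProduct.add_tmul, TensorProduct.tmul_add, hs, ht]
    abel
  | tmul p q =>
    simp only [TensorProduct.assoc_tmul, LinearMap.lTensor_tmul, prepend_tmul, braidMul_tmul,
      braidPast_ι_mul, braidPast₂_tmul, LinearMap.comp_apply]
    exact A.lTensor_qsMul_twist a q u _

theorem braidMul_twist (a b : V) (x : T) (t : V ⊗[K] T) :
    A.braidMul (TensorAlgebra.ι K a * x) (twist A.σ prepend (b ⊗ₜ t)) =
      twist A.σ prepend (a ⊗ₜ A.braidMul x (twist A.σ prepend (b ⊗ₜ t))) +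
      twist A.σ prepend (A.braidMulRight t (A.braidPast b (TensorAlgebra.ι K a * x))) +
      twist A.σ prepend (mergeFirst A.m (V ⊗[K] T)
        (a ⊗ₜ A.braidMulRight t (A.braidPast b x))) := by
  induction t with
  | zero => simp [braidMulRight]
  | tmul c u => exact A.braidMul_twist_tmul a b c x u
  | add s t hs ht =>
    simp only [map_add, TensorProduct.tmul_add, hs, ht, braidMulRight_add, LinearMap.add_apply]
    abel

/-- Braiding a vector past a product. -/
theorem braidPast_qsMul (c : V) (x y : T) :
    A.braidPast c (A.qsMul x y) = A.braidMul x (A.braidPast c y) := by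
  induction y using tensorAlgebra_induction_left generalizing x with
  | one => rw [qsMul_one_right, braidPast_one, braidMul_tmul_one]
  | add y y' hy hy' => simp only [map_add, hy, hy']
  | smul k y hy => simp only [map_smul, hy]
  | ι_mul b y ih =>
    have ih' : A.braidPast c ∘ₗ A.qsMul.flip y = A.braidMul.flip (A.braidPast c y) :=
      LinearMap.ext ih
    have h2 : ∀ s, (A.braidPast c).lTensor V ((A.qsMul.flip y).lTensor V s) =
        A.braidMulRight (A.braidPast c y) s := by
      intro s
      rw [← LinearMap.comp_apply, ← LinearMap.lTensor_comp, ih', braidMulRight]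
    have hp : ∀ s, A.braidPast c (prepend s) = twist A.σ prepend ((A.braidPast c).lTensor V s) :=
      LinearMap.congr_fun (A.braidPast_prepend c)
    have hm : ∀ s, (A.braidPast c).lTensor V (mergeFirst A.m T s) =
        mergeFirst A.m (V ⊗[K] T) (((A.braidPast c).lTensor V).lTensor V s) := fun s =>
      (LinearMap.congr_fun (mergeFirst_comm A.m (A.braidPast c)) s).symm
    induction x using tensorAlgebra_induction_left with
    | one => rw [qsMul_one_left, braidMul_one]
    | add x x' hx hx' => simp only [map_add, LinearMap.add_apply, hx, hx']
    | smul k x hx => simp only [map_smul, LinearMap.smul_apply, hx]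
    | ι_mul a x ihx =>
      -- The recursion gives three terms. The first is handled by the induction on x, the other two
      -- by the induction on y, which holds for all left factors; `braidMul_twist` expands the right
      -- side in the same way.
      rw [qsMul_ι_mul_ι_mul, map_add, map_add, hp, hp, hm, LinearMap.lTensor_tmul, h2, h2,
        braidPast_ι_mul, ihx, braidPast_ι_mul A c b y, braidMul_twist]

/-- Merging after a product: `G_v (x ∗ (b y)) = x ∗ (G_v (b y))`. -/
theorem mergeFirst_braidMul (v b : V) (x y : T) :
    mergeFirst A.m T ((A.braidPast v).lTensor V (A.braidMul x (b ⊗ₜ y))) =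
      A.braidMul x (mergeFirst A.m T (b ⊗ₜ A.braidPast v y)) := by
  have h : A.braidPast v ∘ₗ A.qsMul.flip y = A.braidMul.flip (A.braidPast v y) :=
    LinearMap.ext fun x => A.braidPast_qsMul v x y
  rw [braidMul_tmul, ← LinearMap.comp_apply (f := (A.braidPast v).lTensor V),
    ← LinearMap.lTensor_comp, h, ← braidMulRight]
  -- Both sides are linear in the tensor t. For t = c ⊗ u the claim is that b and c may be
  -- multiplied before or after being braided past x.
  generalize A.braidPast v y = t
  induction t with
  | zero => simp [braidMulRight]
  | add s t hs ht =>
    simp only [map_add, TensorProduct.tmul_add, hs, ht, braidMulRight_add, LinearMap.add_apply]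
  | tmul c u =>
    rw [braidMulRight_tmul_braidPast, mergeFirst_tmul, braidMul_tmul, ← mergeFirst_braidPast₂]
    exact LinearMap.congr_fun (mergeFirst_comm A.m (A.qsMul.flip u)) _

theorem qsMul_ι_mul_ι (a v : V) (x : T) :
    A.qsMul (TensorAlgebra.ι K a * x) (TensorAlgebra.ι K v) =
      TensorAlgebra.ι K a * A.qsMul x (TensorAlgebra.ι K v) +
      prepend (A.braidPast v (TensorAlgebra.ι K a * x)) +
      prepend (mergeFirst A.m T (a ⊗ₜ A.braidPast v x)) := by
  have := A.qsMul_ι_mul_prepend a x (v ⊗ₜ 1)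
  rwa [prepend_tmul, mul_one, braidMul_tmul_one, braidMul_tmul_one] at this

theorem qsMul_prepend_ι (v : V) (t : V ⊗[K] T) :
    A.qsMul (prepend t) (TensorAlgebra.ι K v) =
      prepend ((A.qsMul.flip (TensorAlgebra.ι K v)).lTensor V t) +
      prepend (A.braidPast v (prepend t)) +
      prepend (mergeFirst A.m T ((A.braidPast v).lTensor V t)) := by
  induction t with
  | zero => simp
  | add s t hs ht => simp only [map_add, LinearMap.add_apply, hs, ht]; abel
  | tmul a x => simp [qsMul_ι_mul_ι]

/-- Associativity of the quantum quasi-shuffle product, the third factor being a vector. -/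
theorem qsMul_assoc_ι (x y : T) (v : V) :
    A.qsMul (A.qsMul x y) (TensorAlgebra.ι K v) = A.qsMul x (A.qsMul y (TensorAlgebra.ι K v)) := by
  induction y using tensorAlgebra_induction_left generalizing x with
  | one => rw [qsMul_one_right, qsMul_one_left]
  | add y y' hy hy' => simp only [map_add, LinearMap.add_apply, hy, hy']
  | smul k y hy => simp only [map_smul, LinearMap.smul_apply, hy]
  | ι_mul b y ih =>
    have ih' : A.qsMul.flip (TensorAlgebra.ι K v) ∘ₗ A.qsMul.flip y =
        A.qsMul.flip (A.qsMul y (TensorAlgebra.ι K v)) := LinearMap.ext ih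
    have h1 : ∀ x, (A.qsMul.flip (TensorAlgebra.ι K v)).lTensor V (A.braidMul x (b ⊗ₜ y)) =
        A.braidMul x (b ⊗ₜ A.qsMul y (TensorAlgebra.ι K v)) := by
      intro x
      rw [braidMul_tmul, braidMul_tmul, ← LinearMap.comp_apply, ← LinearMap.lTensor_comp, ih']
    have h2 : ∀ a s, mergeFirst A.m T ((A.braidPast v).lTensor V (mergeFirst A.m T (a ⊗ₜ s))) =
        mergeFirst A.m T (a ⊗ₜ mergeFirst A.m T ((A.braidPast v).lTensor V s)) := by
      intro a s
      have e1 := LinearMap.congr_fun (mergeFirst_comm A.m (A.braidPast v)) (a ⊗ₜ s)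
      have e2 := LinearMap.congr_fun (mergeFirst_mergeFirst A.m_assoc T)
        (a ⊗ₜ (A.braidPast v).lTensor V s)
      simp only [LinearMap.comp_apply, LinearMap.lTensor_tmul] at e1 e2
      rw [← e1, e2]
    have h3 : ∀ a s, (A.qsMul.flip (TensorAlgebra.ι K v)).lTensor V (mergeFirst A.m T (a ⊗ₜ s)) =
        mergeFirst A.m T (a ⊗ₜ (A.qsMul.flip (TensorAlgebra.ι K v)).lTensor V s) := by
      intro a s
      have := LinearMap.congr_fun (mergeFirst_comm A.m (A.qsMul.flip (TensorAlgebra.ι K v)))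
        (a ⊗ₜ s)
      simpa using this.symm
    have hy : A.qsMul (TensorAlgebra.ι K b * y) (TensorAlgebra.ι K v) =
        prepend (b ⊗ₜ A.qsMul y (TensorAlgebra.ι K v) +
          A.braidPast v (TensorAlgebra.ι K b * y) + mergeFirst A.m T (b ⊗ₜ A.braidPast v y)) := by
      rw [qsMul_ι_mul_ι, map_add, map_add, prepend_tmul]
    induction x using tensorAlgebra_induction_left with
    | one => rw [qsMul_one_left, qsMul_one_left]
    | add x x' hx hx' => simp only [map_add, LinearMap.add_apply, hx, hx']
    | smul k x hx => simp only [map_smul, LinearMap.smul_apply, hx]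
    | ι_mul a x ihx =>
      have hxy : A.qsMul (TensorAlgebra.ι K a * x) (TensorAlgebra.ι K b * y) =
          prepend (a ⊗ₜ A.qsMul x (TensorAlgebra.ι K b * y) +
            A.braidMul (TensorAlgebra.ι K a * x) (b ⊗ₜ y) +
            mergeFirst A.m T (a ⊗ₜ A.braidMul x (b ⊗ₜ y))) := by
        rw [qsMul_ι_mul_ι_mul, map_add, map_add, prepend_tmul, braidMul_tmul, braidMul_tmul]
      have hβ : ∀ x, A.braidPast v (A.qsMul x (TensorAlgebra.ι K b * y)) =
          A.braidMul x (A.braidPast v (TensorAlgebra.ι K b * y)) :=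
        fun x => A.braidPast_qsMul v x _
      conv_rhs => rw [hy, qsMul_ι_mul_prepend, ← hy, ← ihx]
      conv_lhs => rw [hxy, qsMul_prepend_ι, ← hxy, hβ]
      -- Each side has seven terms, one for each nonempty subset of {a, b, v} whose product forms
      -- the first letter; the rewriting makes corresponding terms equal.
      simp only [map_add, LinearMap.lTensor_tmul, TensorProduct.tmul_add, h1, h2, h3, hβ,
        mergeFirst_braidMul, LinearMap.flip_apply, prepend_tmul]
      abel

end BraidedAlgebra

/-! ### Runs of transpositions and bubble indices -/

section Permutations

theorem adjSwap_apply {n t : ℕ} (ht : 1 ≤ t) (htn : t < n) (i : Fin n) :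
    (adjSwap n t i : ℕ) = if (i : ℕ) = t - 1 then t else if (i : ℕ) = t then t - 1 else i := by
  rw [adjSwap, dif_pos ⟨ht, htn⟩, Equiv.swap_apply_def]
  simp only [Fin.ext_iff]
  split_ifs <;> rfl

/-- Downward induction on `t`; the empty run `t = k + 1` is admitted as its base. -/
theorem prod_adjSwap_apply {n k t : ℕ} (ht : 1 ≤ t) (htk : t ≤ k + 1) (hk : k < n) (i : Fin n) :
    ((((List.Ico t (k + 1)).map (adjSwap n)).prod i : Fin n) : ℕ) =
      if (i : ℕ) + 1 < t then (i : ℕ) else if (i : ℕ) < k then i + 1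
        else if (i : ℕ) = k then t - 1 else i := by
  induction h : k + 1 - t generalizing t with
  | zero =>
    rw [List.Ico.eq_nil_of_le (by omega)]
    simp only [List.map_nil, List.prod_nil, Equiv.Perm.one_apply]
    split_ifs <;> omega
  | succ d ih =>
    rw [List.Ico.eq_cons (by omega), List.map_cons, List.prod_cons, Equiv.Perm.mul_apply,
      adjSwap_apply ht (by omega), ih (by omega) (by omega) (by omega)]
    split_ifs <;> omega

theorem bubble_zero (n k : ℕ) : bubble n k 0 = 1 := if_pos rfl

theorem bubble_apply {n k t : ℕ} (ht : 1 ≤ t) (htk : t ≤ k) (hk : k < n) (i : Fin n) :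
    (bubble n k t i : ℕ) = if (i : ℕ) + 1 < t then (i : ℕ) else if (i : ℕ) < k then i + 1
        else if (i : ℕ) = k then t - 1 else i := by
  rw [bubble, if_neg (by omega), prod_adjSwap_apply ht (by omega) hk]

theorem permArrow_apply_add {m n : ℕ} (l : ℕ) (h : l + m ≤ n) (s : Equiv.Perm (Fin m))
    (i : Fin m) : permArrow l h s ⟨l + i, by omega⟩ = ⟨l + s i, by omega⟩ :=
  Equiv.Perm.viaEmbedding_apply s ((Fin.natAddEmb l).trans (Fin.castLEEmb h)) i

theorem permArrow_apply_of_lt {m n : ℕ} (l : ℕ) (h : l + m ≤ n) (s : Equiv.Perm (Fin m))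
    (i : Fin n) (hi : (i : ℕ) < l ∨ l + m ≤ i) : permArrow l h s i = i := by
  refine Equiv.Perm.viaEmbedding_apply_of_notMem _ _ _ ?_
  rintro ⟨j, rfl⟩
  simp at hi
  omega

theorem permArrow_injective {m n : ℕ} (l : ℕ) (h : l + m ≤ n) :
    Function.Injective (permArrow (m := m) l h) := by
  intro r s hrs
  exact Equiv.Perm.viaEmbeddingHom_injective ((Fin.natAddEmb l).trans (Fin.castLEEmb h)) hrs

theorem permArrow_one {m n : ℕ} (l : ℕ) (h : l + m ≤ n) :
    permArrow l h (1 : Equiv.Perm (Fin m)) = 1 :=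
  map_one (Equiv.Perm.viaEmbeddingHom ((Fin.natAddEmb l).trans (Fin.castLEEmb h)))

theorem permArrow_bubble {n l p t : ℕ} (h : l + (p + 1) ≤ n) (ht : 1 ≤ t) (htp : t ≤ p) :
    permArrow l h (bubble (p + 1) p t) = bubble n (l + p) (l + t) := by
  ext i
  rw [bubble_apply (by omega) (by omega) (by omega)]
  by_cases hi : (i : ℕ) < l ∨ l + (p + 1) ≤ i
  · rw [permArrow_apply_of_lt l h _ i hi]
    split_ifs <;> omega
  · have hb : ∀ j : Fin (p + 1), l + (j : ℕ) < n := fun j => by omega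
    obtain ⟨j, rfl⟩ : ∃ j : Fin (p + 1), i = ⟨l + j, hb j⟩ :=
      ⟨⟨i - l, by omega⟩, by ext; simp; omega⟩
    rw [permArrow_apply_add]
    simp only [bubble_apply ht htp (Nat.lt_succ_self p)]
    split_ifs <;> omega

/-- A permutation shifted by `l` keeps position `l + p` at or beyond `l`, while a run starting at `t
≤ l` moves it to `t - 1`. For such `t` the map M_{l+p,1} vanishes. -/
theorem permArrow_ne_bubble {n l p t : ℕ} (h : l + (p + 1) ≤ n) (ht : 1 ≤ t) (htl : t ≤ l)
    (r : Equiv.Perm (Fin (p + 1))) : permArrow l h r ≠ bubble n (l + p) t := by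
  intro e
  have h1 := congrArg Fin.val (congrArg (fun s => s ⟨l + p, by omega⟩) e)
  have h2 := congrArg Fin.val (permArrow_apply_add l h r (Fin.last p))
  simp only [Fin.val_last] at h2
  simp only [h2, bubble_apply ht (by omega : t ≤ l + p) (by omega : l + p < n)] at h1
  split_ifs at h1 <;> omega

/-- A sum over the permutations that are shifts of a run `s_t ⋯ s_{l+p}`. -/
theorem sum_permArrow_eq_bubble {M : Type*} [AddCommMonoid M] {n l p : ℕ} (h : l + (p + 1) ≤ n)
    (g : Equiv.Perm (Fin (p + 1)) → M)
    [∀ r t, Decidable (permArrow (n := n) l h r = bubble n (l + p) t)] :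
    ∑ t ∈ Finset.range (l + p + 1), ∑ r : Equiv.Perm (Fin (p + 1)),
      (if permArrow (n := n) l h r = bubble n (l + p) t then g r else 0) =
    ∑ t ∈ Finset.range (p + 1), g (bubble (p + 1) p t) := by
  have hit : ∀ t r, permArrow (n := n) l h r = bubble n (l + p) t →
      ∑ r : Equiv.Perm (Fin (p + 1)),
        (if permArrow (n := n) l h r = bubble n (l + p) t then g r else 0) = g r := by
    intro t r hr
    rw [Finset.sum_eq_single r, if_pos hr]
    · intro r' _ hne
      exact if_neg fun e => hne (permArrow_injective l h (e.trans hr.symm))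
    · simp
  -- The range is cut into the identity `t = 0`, the runs with `1 ≤ t ≤ l`, which contribute
  -- nothing, and the runs beyond `l`, each of which is hit exactly once.
  rw [Finset.sum_range_succ', Finset.sum_range_succ', Finset.sum_range_add,
    Finset.sum_eq_zero, zero_add]
  · congr 1
    · refine Finset.sum_congr rfl fun t ht => ?_
      rw [Finset.mem_range] at ht
      exact hit _ _ (permArrow_bubble h (by omega) (by omega))
    · refine hit _ _ ?_
      rw [bubble_zero, bubble_zero, permArrow_one]
  · intro t ht
    rw [Finset.mem_range] at ht
    exact Finset.sum_eq_zero fun r _ => if_neg (permArrow_ne_bubble h (by omega) (by omega) r)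

theorem bubbleIndex_eq {n : ℕ} (s : Equiv.Perm (Fin n)) {k : ℕ} (h : k < n) :
    bubbleIndex s k =
      if (Finset.univ.filter fun j : Fin n => (j : ℕ) ≤ k ∧ s j ≤ s ⟨k, h⟩).card = k + 1 then 0
      else (Finset.univ.filter fun j : Fin n => (j : ℕ) ≤ k ∧ s j ≤ s ⟨k, h⟩).card :=
  dif_pos h

theorem card_filter_le {n k : ℕ} (h : k < n) :
    (Finset.univ.filter fun j : Fin n => (j : ℕ) ≤ k).card = k + 1 := by
  have : (Finset.univ.filter fun j : Fin n => (j : ℕ) ≤ k) = Finset.Iic ⟨k, h⟩ := by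
    ext j; simp [Fin.le_def]
  rw [this, Fin.card_Iic]

theorem card_filter_le_and_le {n : ℕ} (s : Equiv.Perm (Fin n)) {k : ℕ} (h : k < n) :
    (Finset.univ.filter fun j : Fin n => (j : ℕ) ≤ k ∧ s j ≤ s ⟨k, h⟩).card ≤ k + 1 := by
  rw [← card_filter_le h]
  exact Finset.card_le_card (Finset.monotone_filter_right _ fun j _ hj => hj.1)

theorem bubbleIndex_le {n : ℕ} (s : Equiv.Perm (Fin n)) (k : ℕ) : bubbleIndex s k ≤ k := by
  by_cases h : k < n
  · rw [bubbleIndex_eq s h]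
    have := card_filter_le_and_le s h
    split_ifs <;> omega
  · rw [bubbleIndex, dif_neg h]; omega

/-- The count is never 0, since the entry itself is counted; so index 0 can only stand for the full
count `k + 1`, and nothing is lost. -/
theorem card_eq_of_bubbleIndex_eq {n : ℕ} {s s' : Equiv.Perm (Fin n)} {k : ℕ} (h : k < n)
    (e : bubbleIndex s k = bubbleIndex s' k) :
    (Finset.univ.filter fun j : Fin n => (j : ℕ) ≤ k ∧ s j ≤ s ⟨k, h⟩).card =
      (Finset.univ.filter fun j : Fin n => (j : ℕ) ≤ k ∧ s' j ≤ s' ⟨k, h⟩).card := by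
  have pos : ∀ s : Equiv.Perm (Fin n),
      0 < (Finset.univ.filter fun j : Fin n => (j : ℕ) ≤ k ∧ s j ≤ s ⟨k, h⟩).card := fun s =>
    Finset.card_pos.2 ⟨⟨k, h⟩, by simp⟩
  have h1 := pos s
  have h2 := pos s'
  rw [bubbleIndex_eq s h, bubbleIndex_eq s' h] at e
  split_ifs at e <;> omega

/-- The relative order of the first entries is determined by the bubble indices. -/
theorem le_iff_le_of_bubbleIndex_eq {n : ℕ} {s s' : Equiv.Perm (Fin n)}
    (e : ∀ k < n, bubbleIndex s k = bubbleIndex s' k) (k : ℕ) :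
    ∀ i j : Fin n, (i : ℕ) < k → (j : ℕ) < k → (s i ≤ s j ↔ s' i ≤ s' j) := by
  induction k with
  | zero => intro i j hi; omega
  | succ k ih =>
    by_cases h : k < n
    swap
    · intro i j _ _; exact ih i j (by omega) (by omega)
    -- By induction `s` and `s'` order the first k entries alike. Apart from entry k itself, both
    -- sets are initial segments of this common order, so equal cardinality makes them equal.
    have sets : (Finset.univ.filter fun j : Fin n => (j : ℕ) ≤ k ∧ s j ≤ s ⟨k, h⟩) =
        (Finset.univ.filter fun j : Fin n => (j : ℕ) ≤ k ∧ s' j ≤ s' ⟨k, h⟩) := by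
      have hc := card_eq_of_bubbleIndex_eq h (e k h)
      by_cases hs : (Finset.univ.filter fun j : Fin n => (j : ℕ) ≤ k ∧ s j ≤ s ⟨k, h⟩) ⊆
        (Finset.univ.filter fun j : Fin n => (j : ℕ) ≤ k ∧ s' j ≤ s' ⟨k, h⟩)
      · exact Finset.eq_of_subset_of_card_le hs hc.ge
      -- If some `a` lies only in the first set, every entry of the second set other than k precedes
      -- `a` in the common order, which gives the reverse inclusion.
      · refine (Finset.eq_of_subset_of_card_le ?_ hc.le).symm
        obtain ⟨a, ha, ha'⟩ := Finset.not_subset.1 hs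
        simp only [Finset.mem_filter, Finset.mem_univ, true_and, not_and, not_le] at ha ha'
        have ha'' := ha' ha.1
        have hak : (a : ℕ) ≠ k := fun hak => by
          have : a = ⟨k, h⟩ := Fin.ext hak
          rw [this] at ha''
          exact lt_irrefl _ ha''
        intro b hb
        simp only [Finset.mem_filter, Finset.mem_univ, true_and] at hb ⊢
        refine ⟨hb.1, ?_⟩
        by_cases hbk : (b : ℕ) = k
        · have : b = ⟨k, h⟩ := Fin.ext hbk
          rw [this]
        · have h1 : s' b ≤ s' a := hb.2.trans ha''.le
          exact ((ih b a (by omega) (by omega)).2 h1).trans ha.2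
    have key : ∀ j : Fin n, (j : ℕ) ≤ k → (s j ≤ s ⟨k, h⟩ ↔ s' j ≤ s' ⟨k, h⟩) := by
      intro j hj
      have := Finset.ext_iff.1 sets j
      simpa [hj] using this
    intro i j hi hj
    by_cases hjk : (j : ℕ) = k
    · have : j = ⟨k, h⟩ := Fin.ext hjk
      rw [this]
      exact key i (by omega)
    · by_cases hik : (i : ℕ) = k
      · have hi' : i = ⟨k, h⟩ := Fin.ext hik
        have hne : j ≠ ⟨k, h⟩ := fun hh => hjk (congrArg Fin.val hh)
        rw [hi']
        have h1 : s ⟨k, h⟩ ≤ s j ↔ ¬ s j ≤ s ⟨k, h⟩ := by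
          rw [not_le]
          exact ⟨fun hl => lt_of_le_of_ne hl fun hh => hne (s.injective hh).symm, le_of_lt⟩
        have h2 : s' ⟨k, h⟩ ≤ s' j ↔ ¬ s' j ≤ s' ⟨k, h⟩ := by
          rw [not_le]
          exact ⟨fun hl => lt_of_le_of_ne hl fun hh => hne (s'.injective hh).symm, le_of_lt⟩
        rw [h1, h2, key j (by omega)]
      · exact ih i j (by omega) (by omega)

/-- Equal indices give equal relative orders, so `s' ∘ s⁻¹` is an order automorphism of `Fin n`,
hence trivial. -/
theorem eq_of_bubbleIndex_eq {n : ℕ} {s s' : Equiv.Perm (Fin n)}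
    (e : ∀ k < n, bubbleIndex s k = bubbleIndex s' k) : s = s' := by
  have h := fun i j => le_iff_le_of_bubbleIndex_eq e n i j i.2 j.2
  let f : Fin n ≃o Fin n :=
    { toEquiv := s.symm.trans s'
      map_rel_iff' := by
        intro a b
        have := h (s.symm a) (s.symm b)
        simpa using this.symm }
  have hf : f = OrderIso.refl _ := Subsingleton.elim _ _
  ext i
  have := congrArg (fun g : Fin n ≃o Fin n => g (s i)) hf
  have h' : f (s i) = s' i := by simp [f]
  rw [← h', this]
  rfl

/-- Permutations correspond to sequences of bubble indices. -/
theorem bijective_bubbleIndex (n : ℕ) : Function.Bijective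
    (fun (s : Equiv.Perm (Fin n)) (i : Fin n) =>
      (⟨bubbleIndex s i, Nat.lt_succ_of_le (bubbleIndex_le s i)⟩ : Fin ((i : ℕ) + 1))) := by
  rw [Fintype.bijective_iff_injective_and_card]
  constructor
  · intro s s' hs
    refine eq_of_bubbleIndex_eq fun k hk => ?_
    exact congrArg Fin.val (congrFun hs ⟨k, hk⟩)
  -- Both sides have n! elements.
  · rw [Fintype.card_perm, Fintype.card_pi, Fintype.card_fin]
    simp only [Fintype.card_fin]
    rw [Fin.prod_univ_eq_prod_range (fun i => i + 1) n, Finset.prod_range_add_one_eq_factorial]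

theorem isShuffle_bubble {p t : ℕ} (htp : t ≤ p) :
    IsShuffle p 1 (bubble (p + 1) p t) := by
  rcases Nat.eq_zero_or_pos t with rfl | ht
  · rw [bubble_zero]
    exact ⟨fun i _ j _ h => h, fun i _ j _ h => h⟩
  · constructor
    · intro i hi j hj hij
      rw [Fin.lt_def] at hij ⊢
      simp only [Set.mem_ofPred_eq] at hi hj
      rw [bubble_apply ht htp (Nat.lt_succ_self p), bubble_apply ht htp (Nat.lt_succ_self p)]
      split_ifs <;> omega
    · intro i hi j hj hij
      simp only [Set.mem_ofPred_eq] at hi hj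
      rw [Fin.lt_def] at hij
      omega

theorem bubbleIndex_one (n k : ℕ) : bubbleIndex (1 : Equiv.Perm (Fin n)) k = 0 := by
  by_cases h : k < n
  · rw [bubbleIndex_eq _ h, if_pos]
    rw [← card_filter_le h]
    congr 1
    ext j
    simp [Fin.le_def]
  · rw [bubbleIndex, dif_neg h]

theorem bubbleIndex_bubble_of_lt {p t k : ℕ} (ht : 1 ≤ t) (htp : t ≤ p) (hk : k < p) :
    bubbleIndex (bubble (p + 1) p t) k = 0 := by
  have h : k < p + 1 := by omega
  rw [bubbleIndex_eq _ h, if_pos]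
  rw [← card_filter_le h]
  congr 1
  ext j
  simp only [Finset.mem_filter, Finset.mem_univ, true_and, Fin.le_def,
    bubble_apply ht htp (Nat.lt_succ_self p)]
  split_ifs <;> omega

theorem bubbleIndex_bubble_self {p t : ℕ} (ht : 1 ≤ t) (htp : t ≤ p) :
    bubbleIndex (bubble (p + 1) p t) p = t := by
  have h : p < p + 1 := by omega
  have hc : (Finset.univ.filter fun j : Fin (p + 1) => (j : ℕ) ≤ p ∧
      bubble (p + 1) p t j ≤ bubble (p + 1) p t ⟨p, h⟩).card = t := by
    -- Position p is sent to t - 1, and only the first t - 1 positions land before it.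
    have : (Finset.univ.filter fun j : Fin (p + 1) => (j : ℕ) ≤ p ∧
        bubble (p + 1) p t j ≤ bubble (p + 1) p t ⟨p, h⟩) =
        insert ⟨p, h⟩ (Finset.Iio ⟨t - 1, by omega⟩) := by
      ext j
      simp only [Finset.mem_filter, Finset.mem_univ, true_and, Fin.le_def, Finset.mem_insert,
        Finset.mem_Iio, Fin.lt_def, Fin.ext_iff, bubble_apply ht htp (Nat.lt_succ_self p)]
      split_ifs <;> omega
    rw [this, Finset.card_insert_of_notMem, Fin.card_Iio]
    · simp; omega
    · simp [Fin.lt_def]; omega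
  rw [bubbleIndex_eq _ h, hc, if_neg (by omega)]

end Permutations

/-! ### The total symmetrization element as an iterated sum -/

section Lifting

variable (K : Type u) [Field K]

/-- The lift `Q_{p,1}` of `s_t ⋯ s_p`, and of the identity for `t = 0`. -/
def bubbleLift (p t : ℕ) : MonoidAlgebra K (GVB (p + 1)) :=
  if t = 0 then 1 else
    (braidElt K (p + 1) t + braidRun K (p + 1) 1 (t - 1) * virtElt K (p + 1) t) *
      braidRun K (p + 1) (t + 1) p

/-- A run ending in s_p has only one nontrivial bubble factor, the last one, so the product defining
the lift has a single factor. -/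
theorem liftShuffle_bubble {p t : ℕ} (htp : t ≤ p) :
    liftShuffle K p 1 (bubble (p + 1) p t) = bubbleLift K p t := by
  rw [liftShuffle, if_pos (isShuffle_bubble htp), bubbleLift]
  split_ifs with ht
  · subst ht
    rw [bubble_zero]
    simp [bubbleIndex_one]
  · have h1 : 1 ≤ t := by omega
    have hI : List.Ico 1 (p + 1) = List.Ico 1 p ++ [p] := List.Ico.succ_top (by omega)
    have hf : ((List.Ico 1 p).reverse.filter
        fun k => bubbleIndex (bubble (p + 1) p t) k ≠ 0) = [] := by
      rw [List.filter_eq_nil_iff]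
      intro k hk
      rw [List.mem_reverse, List.Ico.mem] at hk
      simp [bubbleIndex_bubble_of_lt h1 htp hk.2]
    -- The index beyond the range defaults to 0, so the Kronecker delta vanishes and the virtual
    -- term is kept.
    have hp1 : bubbleIndex (bubble (p + 1) p t) (p + 1) = 0 := by
      rw [bubbleIndex, dif_neg (by omega)]
    rw [hI, List.reverse_append, List.reverse_singleton, List.singleton_append, List.filter_cons,
      if_pos (by simpa [bubbleIndex_bubble_self h1 htp] using ht), hf]
    simp only [List.map_cons, List.map_nil, List.prod_cons, List.prod_nil, mul_one,
      bubbleIndex_bubble_self h1 htp, hp1]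
    rw [if_neg (by omega)]

/-- Of all the runs only those shifted by the virtual length `l` of τ survive, and they are indexed
by the runs in `p + 1 = k + 1 - l` strands. -/
theorem sum_liftStepMonoid_bubble {n k l p : ℕ} (τ : GVB n)
    (hτ : (virtLength n τ).toAdd = l) (hlp : l + p = k) (hp : 1 ≤ p) (hk : k < n) :
    ∑ t ∈ Finset.range (k + 1), liftStepMonoid K n k 1 (bubble n k t) τ =
      (∑ t ∈ Finset.range (p + 1), MonoidAlgebra.mapDomainAlgHom K K
        (arrow l (by omega : l + (p + 1) ≤ n)) (bubbleLift K p t)) * MonoidAlgebra.of K _ τ := by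
  classical
  subst hτ
  obtain rfl : p = k - (virtLength n τ).toAdd := by omega
  have hk' : (virtLength n τ).toAdd < k ∧ k + 1 ≤ n := by omega
  simp only [liftStepMonoid, dif_pos hk']
  rw [← Finset.sum_mul]
  congr 1
  have := sum_permArrow_eq_bubble (n := n) (l := (virtLength n τ).toAdd)
    (p := k - (virtLength n τ).toAdd) (by omega) (fun r =>
      MonoidAlgebra.mapDomainAlgHom K K (arrow (virtLength n τ).toAdd
        (by omega : (virtLength n τ).toAdd + (k - (virtLength n τ).toAdd + 1) ≤ n))
          (liftShuffle K (k - (virtLength n τ).toAdd) 1 r))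
  simp only [hlp] at this
  convert this using 2 with t ht
  rw [Finset.mem_range] at ht
  rw [liftShuffle_bubble K (by omega)]

/-- The sum of the `k`-step iterated lifts of all permutations of the first `k + 1` entries. -/
def symmIter (n : ℕ) : ℕ → MonoidAlgebra K (GVB n)
  | 0 => 1
  | k + 1 => ∑ t ∈ Finset.range (k + 2), liftStep K n (k + 1) 1 (bubble n (k + 1) t) (symmIter n k)

/-- The iterated lift along a sequence of bubble indices. -/
def codeIter (n : ℕ) (c : ℕ → ℕ) : ℕ → MonoidAlgebra K (GVB n)
  | 0 => 1
  | k + 1 => liftStep K n (k + 1) 1 (bubble n (k + 1) (c (k + 1))) (codeIter n c k)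

theorem liftIter_eq_codeIter (n : ℕ) (s : Equiv.Perm (Fin n)) (k : ℕ) :
    liftIter K n s k = codeIter K n (bubbleIndex s) k := by
  induction k with
  | zero => rfl
  | succ k ih => rw [liftIter, codeIter, ih, bubbleFactor]

theorem codeIter_congr (n : ℕ) {c d : ℕ → ℕ} (k : ℕ) (h : ∀ j ≤ k, c j = d j) :
    codeIter K n c k = codeIter K n d k := by
  induction k with
  | zero => rfl
  | succ k ih => rw [codeIter, codeIter, ih fun j hj => h j (by omega), h (k + 1) le_rfl]

/-- Since `liftStep` is linear in its last argument, the sum over codes can be taken one index at a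
time, splitting off the last entry. The entry 0 lies in `Fin 1` and carries no choice; codes are
extended by 0. -/
theorem sum_codeIter (n k : ℕ) :
    ∑ c : (∀ i : Fin (k + 1), Fin ((i : ℕ) + 1)),
      codeIter K n (fun j => if h : j < k + 1 then (c ⟨j, h⟩ : ℕ) else 0) k = symmIter K n k := by
  induction k with
  | zero => simp [codeIter, symmIter]
  | succ k ih =>
    rw [symmIter, ← ih, ← (Fin.snocEquiv fun i : Fin (k + 2) => Fin ((i : ℕ) + 1)).sum_comp,
      Fintype.sum_prod_type]
    rw [← Fin.sum_univ_eq_sum_range (fun t => liftStep K n (k + 1) 1 (bubble n (k + 1) t) _)]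
    refine Finset.sum_congr rfl fun t _ => ?_
    rw [map_sum]
    refine Finset.sum_congr rfl fun c _ => ?_
    rw [codeIter]
    refine congrArg₂ (fun r x => liftStep K n (k + 1) 1 (bubble n (k + 1) r) x) ?_ ?_
    · rw [dif_pos (by omega)]
      exact congrArg Fin.val (Fin.snoc_last (α := fun i : Fin (k + 2) => Fin ((i : ℕ) + 1)) t c)
    · refine codeIter_congr K n k fun j hj => ?_
      rw [dif_pos (by omega), dif_pos (by omega)]
      exact congrArg Fin.val (Fin.snoc_castSucc (α := fun i : Fin (k + 2) => Fin ((i : ℕ) + 1))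
        t c ⟨j, by omega⟩)

theorem totalSymmElt_succ (n : ℕ) : totalSymmElt K (n + 1) = symmIter K (n + 1) n := by
  rw [totalSymmElt, ← sum_codeIter]
  refine Function.Bijective.sum_comp (bijective_bubbleIndex (n + 1)) _ |>.symm.trans ?_ |>.symm
  refine Finset.sum_congr rfl fun s _ => ?_
  rw [lift, liftIter_eq_codeIter, Nat.add_sub_cancel]
  refine codeIter_congr K _ _ fun j hj => ?_
  rw [dif_pos (by omega)]

end Lifting

/-! ### Local operators, their runs and degrees on the tensor algebra -/

section LocalOperators

variable {K : Type u} [Field K] {V : Type v} [AddCommGroup V] [Module K V]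

/-- The operator `id^{⊗ i} ⊗ f ⊗ id ⊗ ⋯` on `T(V)`, equal to `0` in degrees below `i + 2`. -/
def tensorLocalOp (f : V ⊗[K] V →ₗ[K] V ⊗[K] V) (i : ℕ) : Module.End K (TensorAlgebra K V) :=
  DirectSum.toModule K ℕ (TensorAlgebra K V)
    (fun n => TensorPower.toTensorAlgebra ∘ₗ localOp f n i) ∘ₗ
    TensorAlgebra.equivDirectSum.toLinearMap

theorem tensorLocalOp_toTensorAlgebra (f : V ⊗[K] V →ₗ[K] V ⊗[K] V) (i n : ℕ) (x : ⨂[K]^n V) :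
    tensorLocalOp f i (TensorPower.toTensorAlgebra x) =
      TensorPower.toTensorAlgebra (localOp f n i x) := by
  rw [tensorLocalOp, LinearMap.comp_apply, AlgEquiv.toLinearMap_apply,
    equivDirectSum_toTensorAlgebra]
  erw [DirectSum.toModule_lof]
  rfl

theorem tensorLocalOp_succ (f : V ⊗[K] V →ₗ[K] V ⊗[K] V) (i : ℕ) (a : V)
    (x : TensorAlgebra K V) : tensorLocalOp f (i + 1) (TensorAlgebra.ι K a * x) =
      TensorAlgebra.ι K a * tensorLocalOp f i x := by
  induction x using tensorAlgebra_induction_homogeneous with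
  | add x y hx hy => simp only [mul_add, map_add, hx, hy]
  | homogeneous n x =>
    rw [← toTensorAlgebra_consEquiv, tensorLocalOp_toTensorAlgebra, tensorLocalOp_toTensorAlgebra,
      localOp, LinearEquiv.conj_apply_apply, LinearEquiv.symm_apply_apply,
      LinearMap.lTensor_tmul, toTensorAlgebra_consEquiv]

/-- The inclusion `V ⊗ V → T(V)`. -/
def pairMul : V ⊗[K] V →ₗ[K] TensorAlgebra K V :=
  LinearMap.mul' K (TensorAlgebra K V) ∘ₗ
    TensorProduct.map (TensorAlgebra.ι K) (TensorAlgebra.ι K)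

theorem pairMul_tmul (a b : V) :
    pairMul (K := K) (a ⊗ₜ b) = TensorAlgebra.ι K a * TensorAlgebra.ι K b := by
  simp [pairMul]

theorem tensorLocalOp_zero (f : V ⊗[K] V →ₗ[K] V ⊗[K] V) (a b : V) (x : TensorAlgebra K V) :
    tensorLocalOp f 0 (TensorAlgebra.ι K a * (TensorAlgebra.ι K b * x)) =
      pairMul (f (a ⊗ₜ b)) * x := by
  induction x using tensorAlgebra_induction_homogeneous with
  | add x y hx hy => simp only [mul_add, map_add, hx, hy]
  | homogeneous n x =>
    have hs : ∀ t, (split₂ n).symm t =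
        consEquiv (n + 1) ((consEquiv (K := K) n).toLinearMap.lTensor V t) := by
      intro t
      rw [split₂, LinearEquiv.trans_symm, LinearEquiv.trans_apply, LinearEquiv.symm_symm]
      rfl
    have h1 : consEquiv (n + 1) (a ⊗ₜ consEquiv n (b ⊗ₜ x)) =
        (split₂ n).symm (a ⊗ₜ (b ⊗ₜ x)) := by rw [hs]; rfl
    rw [← toTensorAlgebra_consEquiv, ← toTensorAlgebra_consEquiv, tensorLocalOp_toTensorAlgebra,
      h1, localOp, LinearEquiv.conj_apply_apply, LinearEquiv.symm_symm,
      LinearEquiv.apply_symm_apply, onFirstTwo_tmul, hs]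
    generalize f (a ⊗ₜ b) = s
    induction s with
    | zero => simp
    | add s t hs ht => simp only [TensorProduct.add_tmul, map_add, hs, ht, add_mul]
    | tmul p q => simp [toTensorAlgebra_consEquiv, pairMul_tmul, mul_assoc]

/-- The operator `f_a f_{a+1} ⋯ f_{b-1}` on `T(V)`, positions being numbered from `0`. -/
def opRun (f : V ⊗[K] V →ₗ[K] V ⊗[K] V) (a b : ℕ) : Module.End K (TensorAlgebra K V) :=
  ((List.Ico a b).map (tensorLocalOp f)).prod

theorem opRun_self (f : V ⊗[K] V →ₗ[K] V ⊗[K] V) (a : ℕ) : opRun f a a = 1 := by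
  simp [opRun]

theorem opRun_eq_mul (f : V ⊗[K] V →ₗ[K] V ⊗[K] V) {a b : ℕ} (h : a < b) :
    opRun f a b = tensorLocalOp f a * opRun f (a + 1) b := by
  rw [opRun, List.Ico.eq_cons h, List.map_cons, List.prod_cons, opRun]

theorem opRun_succ (f : V ⊗[K] V →ₗ[K] V ⊗[K] V) (a b : ℕ) (c : V) (x : TensorAlgebra K V) :
    opRun f (a + 1) (b + 1) (TensorAlgebra.ι K c * x) = TensorAlgebra.ι K c * opRun f a b x := by
  have : List.Ico (a + 1) (b + 1) = (List.Ico a b).map (1 + ·) := (List.Ico.map_add a b 1).symm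
  rw [opRun, opRun, this, List.map_map]
  induction List.Ico a b with
  | nil => simp
  | cons i l ih =>
    simp only [List.map_cons, List.prod_cons, Module.End.mul_apply, ih, Function.comp_apply,
      Nat.add_comm 1 i, tensorLocalOp_succ]

/-- The sum of the runs `f_{l+t} ⋯ f_{l+p-1}`, `0 ≤ t ≤ p`. -/
def braidSum (f : V ⊗[K] V →ₗ[K] V ⊗[K] V) (l p : ℕ) : Module.End K (TensorAlgebra K V) :=
  ∑ t ∈ Finset.range (p + 1), opRun f (l + t) (l + p)

/-- The sum of the products `(f_l ⋯ f_{l+t-1}) g_{l+t} (f_{l+t+1} ⋯ f_{l+p-1})`, `0 ≤ t < p`. -/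
def virtSum (f g : V ⊗[K] V →ₗ[K] V ⊗[K] V) (l p : ℕ) : Module.End K (TensorAlgebra K V) :=
  ∑ t ∈ Finset.range p,
    opRun f l (l + t) * tensorLocalOp g (l + t) * opRun f (l + t + 1) (l + p)

theorem braidSum_succ (f : V ⊗[K] V →ₗ[K] V ⊗[K] V) (l p : ℕ) (c : V) (x : TensorAlgebra K V) :
    braidSum f (l + 1) p (TensorAlgebra.ι K c * x) = TensorAlgebra.ι K c * braidSum f l p x := by
  simp only [braidSum, LinearMap.sum_apply, Finset.mul_sum]
  refine Finset.sum_congr rfl fun t _ => ?_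
  rw [add_right_comm l 1 t, add_right_comm l 1 p, opRun_succ]

theorem virtSum_succ (f g : V ⊗[K] V →ₗ[K] V ⊗[K] V) (l p : ℕ) (c : V) (x : TensorAlgebra K V) :
    virtSum f g (l + 1) p (TensorAlgebra.ι K c * x) =
      TensorAlgebra.ι K c * virtSum f g l p x := by
  simp only [virtSum, LinearMap.sum_apply, Finset.mul_sum]
  refine Finset.sum_congr rfl fun t _ => ?_
  rw [add_right_comm l 1 t, add_right_comm l 1 p]
  simp only [Module.End.mul_apply, opRun_succ, tensorLocalOp_succ]

/-- Operators in positions from `l` on do not see the first `l` letters. It is used with these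
letters equal to 𝟏. -/
theorem braidSum_pow_mul (f : V ⊗[K] V →ₗ[K] V ⊗[K] V) (l p : ℕ) (c : V)
    (x : TensorAlgebra K V) : braidSum f l p (TensorAlgebra.ι K c ^ l * x) =
      TensorAlgebra.ι K c ^ l * braidSum f 0 p x := by
  induction l with
  | zero => simp
  | succ l ih => rw [pow_succ', mul_assoc, braidSum_succ, ih, mul_assoc]

theorem virtSum_pow_mul (f g : V ⊗[K] V →ₗ[K] V ⊗[K] V) (l p : ℕ) (c : V)
    (x : TensorAlgebra K V) : virtSum f g l p (TensorAlgebra.ι K c ^ l * x) =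
      TensorAlgebra.ι K c ^ l * virtSum f g 0 p x := by
  induction l with
  | zero => simp
  | succ l ih => rw [pow_succ', mul_assoc, virtSum_succ, ih, mul_assoc]

/-- Mirrors the recursion for x ∗ c: either the first letter of x stays in front, or c is braided
all the way to the front. -/
theorem braidSum_zero_succ (f : V ⊗[K] V →ₗ[K] V ⊗[K] V) (p : ℕ) :
    braidSum f 0 (p + 1) = braidSum f 1 p + opRun f 0 (p + 1) := by
  rw [braidSum, Finset.sum_range_succ', braidSum]
  simp only [zero_add, Nat.add_comm 1]

/-- Either the multiplication takes place further right and `f` carries the resulting 𝟏 past the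
first letter, or it takes place at the first letter. -/
theorem virtSum_zero_succ (f g : V ⊗[K] V →ₗ[K] V ⊗[K] V) (p : ℕ) :
    virtSum f g 0 (p + 1) =
      tensorLocalOp f 0 * virtSum f g 1 p + tensorLocalOp g 0 * opRun f 1 (p + 1) := by
  rw [virtSum, Finset.sum_range_succ', virtSum, Finset.mul_sum]
  simp only [zero_add, Nat.add_comm 1, opRun_self, one_mul, add_zero]
  congr 1

/-- The subspace `V^{⊗p}` of `T(V)`. -/
abbrev tensorDegree (K : Type u) [Field K] (V : Type v) [AddCommGroup V] [Module K V] (p : ℕ) :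
    Submodule K (TensorAlgebra K V) :=
  LinearMap.range (TensorAlgebra.ι K : V →ₗ[K] TensorAlgebra K V) ^ p

theorem ι_mul_mem_tensorDegree {p : ℕ} (a : V) {x : TensorAlgebra K V}
    (hx : x ∈ tensorDegree K V p) : TensorAlgebra.ι K a * x ∈ tensorDegree K V (p + 1) := by
  rw [tensorDegree, pow_succ']
  exact Submodule.mul_mem_mul ⟨a, rfl⟩ hx

/-- The subspace `V ⊗ V^{⊗p}` of `V ⊗ T(V)`. -/
def tmulDegree (K : Type u) [Field K] (V : Type v) [AddCommGroup V] [Module K V] (p : ℕ) :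
    Submodule K (V ⊗[K] TensorAlgebra K V) :=
  Submodule.map₂ (TensorProduct.mk K V (TensorAlgebra K V)) ⊤ (tensorDegree K V p)

theorem tmul_mem_tmulDegree {p : ℕ} (a : V) {x : TensorAlgebra K V}
    (hx : x ∈ tensorDegree K V p) : a ⊗ₜ x ∈ tmulDegree K V p :=
  Submodule.apply_mem_map₂ _ trivial hx

@[elab_as_elim]
theorem tmulDegree_induction {p : ℕ} {P : V ⊗[K] TensorAlgebra K V → Prop}
    (tmul : ∀ a x, x ∈ tensorDegree K V p → P (a ⊗ₜ x)) (zero : P 0)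
    (add : ∀ s t, P s → P t → P (s + t)) {t : V ⊗[K] TensorAlgebra K V}
    (ht : t ∈ tmulDegree K V p) : P t := by
  rw [tmulDegree, Submodule.map₂_eq_span_image2] at ht
  -- `P` is not assumed stable under scalars, so all multiples are treated at once and the scalar is
  -- absorbed into the vector factor.
  have hs : ∀ t ∈ Submodule.span K (Set.image2
      (fun a x => TensorProduct.mk K V (TensorAlgebra K V) a x)
      ((⊤ : Submodule K V) : Set V) (tensorDegree K V p)), ∀ c : K, P (c • t) := by
    intro t ht
    induction ht using Submodule.span_induction with
    | mem t h =>
      obtain ⟨a, -, x, hx, rfl⟩ := h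
      intro c
      have := tmul (c • a) x hx
      rwa [← TensorProduct.smul_tmul'] at this
    | zero => intro c; rwa [smul_zero]
    | add s t _ _ hs ht => intro c; rw [smul_add]; exact add _ _ (hs c) (ht c)
    | smul d t _ ht => intro c; rw [smul_smul]; exact ht _
  simpa using hs t ht 1

theorem prepend_mem_tensorDegree {p : ℕ} {t : V ⊗[K] TensorAlgebra K V}
    (ht : t ∈ tmulDegree K V p) : BraidedAlgebra.prepend t ∈ tensorDegree K V (p + 1) := by
  refine tmulDegree_induction ?tmul ?zero ?add ht
  case tmul =>
    intro a x hx
    rw [BraidedAlgebra.prepend_tmul]; exact ι_mul_mem_tensorDegree a hx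
  case zero => rw [map_zero]; exact zero_mem _
  case add =>
    intro s t hs ht
    rw [map_add]; exact add_mem hs ht

theorem twist_mem_tmulDegree (f : V ⊗[K] V →ₗ[K] V ⊗[K] V) {p : ℕ} (a : V)
    {t : V ⊗[K] TensorAlgebra K V} (ht : t ∈ tmulDegree K V p) :
    twist f BraidedAlgebra.prepend (a ⊗ₜ t) ∈ tmulDegree K V (p + 1) := by
  refine tmulDegree_induction ?tmul ?zero ?add ht
  case tmul =>
    intro b x hx
    rw [twist, LinearMap.comp_apply, onFirstTwo_tmul]
    generalize f (a ⊗ₜ b) = s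
    induction s with
    | zero => simp
    | add s t hs ht => rw [TensorProduct.add_tmul, map_add, map_add]; exact add_mem hs ht
    | tmul c d =>
      rw [TensorProduct.assoc_tmul, LinearMap.lTensor_tmul, BraidedAlgebra.prepend_tmul]
      exact tmul_mem_tmulDegree _ (ι_mul_mem_tensorDegree _ hx)
  case zero => simp
  case add =>
    intro s t hs ht
    rw [TensorProduct.tmul_add, map_add]; exact add_mem hs ht

theorem mergeFirst_mem_tmulDegree (m : V ⊗[K] V →ₗ[K] V) {p : ℕ} (a : V)
    {t : V ⊗[K] TensorAlgebra K V} (ht : t ∈ tmulDegree K V p) :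
    mergeFirst m (TensorAlgebra K V) (a ⊗ₜ t) ∈ tmulDegree K V p := by
  refine tmulDegree_induction ?tmul ?zero ?add ht
  case tmul =>
    intro b x hx
    rw [mergeFirst_tmul]; exact tmul_mem_tmulDegree _ hx
  case zero => simp
  case add =>
    intro s t hs ht
    rw [TensorProduct.tmul_add, map_add]; exact add_mem hs ht

@[elab_as_elim]
theorem tensorDegree_succ_induction {p : ℕ} {P : TensorAlgebra K V → Prop}
    (ι_mul : ∀ a x, x ∈ tensorDegree K V p → P (TensorAlgebra.ι K a * x))
    (add : ∀ x y, P x → P y → P (x + y)) {x : TensorAlgebra K V}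
    (hx : x ∈ tensorDegree K V (p + 1)) : P x := by
  rw [tensorDegree, pow_succ'] at hx
  refine Submodule.mul_induction_on hx ?_ add
  rintro _ ⟨a, rfl⟩ x hx
  exact ι_mul a x hx

theorem exists_of_mem_tensorDegree_zero {x : TensorAlgebra K V} (hx : x ∈ tensorDegree K V 0) :
    ∃ r : K, x = r • 1 := by
  rw [tensorDegree, pow_zero, Submodule.mem_one] at hx
  obtain ⟨r, rfl⟩ := hx
  exact ⟨r, Algebra.algebraMap_eq_smul_one r⟩

theorem BraidedAlgebra.braidPast_mem_tmulDegree (A : BraidedAlgebra K V) {p : ℕ} (c : V)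
    {x : TensorAlgebra K V} (hx : x ∈ tensorDegree K V p) :
    A.braidPast c x ∈ tmulDegree K V p := by
  induction p generalizing x with
  | zero =>
    obtain ⟨r, rfl⟩ := exists_of_mem_tensorDegree_zero hx
    rw [map_smul, braidPast_one]
    refine Submodule.smul_mem _ _ (tmul_mem_tmulDegree _ ?_)
    rw [tensorDegree, pow_zero]
    exact Submodule.one_le.1 le_rfl
  | succ p ih =>
    refine tensorDegree_succ_induction ?ι_mul ?add hx
    case ι_mul =>
      intro a x hx
      rw [braidPast_ι_mul]; exact twist_mem_tmulDegree _ _ (ih hx)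
    case add =>
      intro x y hx hy
      rw [map_add]; exact add_mem hx hy

end LocalOperators

/-! ### The product with a vector in terms of operators on T(W) -/

namespace UnitalBraidedAlgebra

variable {K : Type u} [Field K] {W : Type v} [AddCommGroup W] [Module K W]
variable (B : UnitalBraidedAlgebra K W)

/-- The inclusion `T(V) → T(W)`. -/
def incl : TensorAlgebra K B.V →ₐ[K] TensorAlgebra K W :=
  TensorAlgebra.lift K (TensorAlgebra.ι K ∘ₗ B.V.subtype)

@[simp] theorem incl_ι (a : B.V) : B.incl (TensorAlgebra.ι K a) = TensorAlgebra.ι K (a : W) := by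
  simp [incl]

theorem deleting_incl (x : TensorAlgebra K B.V) : B.deleting (B.incl x) = x := by
  have : B.deleting.comp B.incl = AlgHom.id K _ := by
    ext a
    simp [deleting_mem]
  exact DFunLike.congr_fun this x

theorem σ_tmul_coe (a c : B.V) : B.σ ((a : W) ⊗ₜ (c : W)) =
    TensorProduct.map B.V.subtype B.V.subtype (B.restr.σ (a ⊗ₜ c)) :=
  (LinearMap.congr_fun B.restr_σ (a ⊗ₜ c)).symm

theorem m_tmul_coe (a c : B.V) : B.m ((a : W) ⊗ₜ (c : W)) = (B.restr.m (a ⊗ₜ c) : W) :=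
  (LinearMap.congr_fun B.restr_m (a ⊗ₜ c)).symm

/-- Because σ restricts to V, its action on the first two letters realizes one step of the braiding
over V; `u` holds the letters not yet treated. -/
theorem tensorLocalOp_σ_incl (a : B.V) (t : B.V ⊗[K] TensorAlgebra K B.V)
    (u : TensorAlgebra K W) :
    tensorLocalOp B.σ 0 (TensorAlgebra.ι K (a : W) * (B.incl (BraidedAlgebra.prepend t) * u)) =
      B.incl (BraidedAlgebra.prepend (twist B.restr.σ BraidedAlgebra.prepend (a ⊗ₜ t))) * u := by
  induction t with
  | zero => simp
  | add s t hs ht => simp only [TensorProduct.tmul_add, map_add, add_mul, mul_add, hs, ht]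
  | tmul c w =>
    rw [BraidedAlgebra.prepend_tmul, map_mul B.incl, incl_ι, mul_assoc, tensorLocalOp_zero, σ_tmul_coe,
      twist, LinearMap.comp_apply, onFirstTwo_tmul]
    generalize B.restr.σ (a ⊗ₜ c) = s
    induction s with
    | zero => simp
    | add s t hs ht => simp only [TensorProduct.add_tmul, map_add, add_mul, hs, ht]
    | tmul p q => simp [pairMul_tmul, mul_assoc]

theorem tensorLocalOp_σm_incl (a : B.V) (t : B.V ⊗[K] TensorAlgebra K B.V)
    (u : TensorAlgebra K W) :
    tensorLocalOp B.σm 0 (TensorAlgebra.ι K (a : W) * (B.incl (BraidedAlgebra.prepend t) * u)) =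
      TensorAlgebra.ι K B.one *
        (B.incl (BraidedAlgebra.prepend (mergeFirst B.restr.m _ (a ⊗ₜ t))) * u) := by
  induction t with
  | zero => simp
  | add s t hs ht => simp only [TensorProduct.tmul_add, map_add, add_mul, mul_add, hs, ht]
  | tmul c w =>
    rw [BraidedAlgebra.prepend_tmul, map_mul B.incl, incl_ι, mul_assoc, tensorLocalOp_zero, σm_tmul,
      m_tmul_coe, pairMul_tmul, mergeFirst_tmul, BraidedAlgebra.prepend_tmul, map_mul, incl_ι,
      mul_assoc, mul_assoc]

theorem tensorLocalOp_σ_one (a : W) (u : TensorAlgebra K W) :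
    tensorLocalOp B.σ 0 (TensorAlgebra.ι K a * (TensorAlgebra.ι K B.one * u)) =
      TensorAlgebra.ι K B.one * (TensorAlgebra.ι K a * u) := by
  rw [tensorLocalOp_zero, B.σ_one_right, pairMul_tmul, mul_assoc]

/-- The rightmost operator acts first, so c crosses the letters of x from the last to the first, as
in β_{p,1}. -/
theorem opRun_incl {p : ℕ} {x : TensorAlgebra K B.V} (hx : x ∈ tensorDegree K B.V p) (c : B.V)
    (u : TensorAlgebra K W) :
    opRun B.σ 0 p (B.incl x * (TensorAlgebra.ι K (c : W) * u)) =
      B.incl (BraidedAlgebra.prepend (B.restr.braidPast c x)) * u := by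
  induction p generalizing x with
  | zero =>
    obtain ⟨r, rfl⟩ := exists_of_mem_tensorDegree_zero hx
    simp [opRun_self, BraidedAlgebra.braidPast_one]
  | succ p ih =>
    refine tensorDegree_succ_induction ?ι_mul ?add hx
    case add =>
      intro x y hx hy
      simp only [map_add, add_mul, hx, hy]
    case ι_mul =>
      intro a x hx
      rw [opRun_eq_mul _ (Nat.succ_pos p), Module.End.mul_apply, map_mul B.incl, incl_ι, mul_assoc,
        zero_add, opRun_succ, ih hx, tensorLocalOp_σ_incl, BraidedAlgebra.braidPast_ι_mul]

/-- The product `x ∗ c` with a vector splits into a part given by braid operators and a part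
given by operators with one virtual generator. -/
theorem exists_qsMul_ι_eq {p : ℕ} {x : TensorAlgebra K B.V} (hx : x ∈ tensorDegree K B.V p)
    (c : B.V) : ∃ y ∈ tensorDegree K B.V (p + 1), ∃ z ∈ tensorDegree K B.V p,
      B.restr.qsMul x (TensorAlgebra.ι K c) = y + z ∧
      ∀ u : TensorAlgebra K W,
        braidSum B.σ 0 p (B.incl x * (TensorAlgebra.ι K (c : W) * u)) = B.incl y * u ∧
        virtSum B.σ B.σm 0 p (B.incl x * (TensorAlgebra.ι K (c : W) * u)) =
          TensorAlgebra.ι K B.one * (B.incl z * u) := by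
  induction p generalizing x with
  | zero =>
    obtain ⟨r, rfl⟩ := exists_of_mem_tensorDegree_zero hx
    refine ⟨r • TensorAlgebra.ι K c, ?_, 0, zero_mem _, ?_, fun u => ⟨?_, ?_⟩⟩
    · refine Submodule.smul_mem _ _ ?_
      rw [zero_add, tensorDegree, pow_one]
      exact ⟨c, rfl⟩
    · simp [BraidedAlgebra.qsMul_one_left]
    · simp [braidSum, opRun_self]
    · simp [virtSum]
  | succ p ih =>
    refine tensorDegree_succ_induction ?ι_mul ?add hx
    case add =>
      intro x x' hx hx'
      obtain ⟨y, hy, z, hz, e, h⟩ := hx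
      obtain ⟨y', hy', z', hz', e', h'⟩ := hx'
      refine ⟨y + y', add_mem hy hy', z + z', add_mem hz hz', ?_, fun u => ⟨?_, ?_⟩⟩
      · rw [map_add, LinearMap.add_apply, e, e']; abel
      · simp only [map_add, add_mul, (h u).1, (h' u).1]
      · simp only [map_add, add_mul, mul_add, (h u).2, (h' u).2]
    case ι_mul =>
      intro a x hx
      obtain ⟨y, hy, z, hz, e, h⟩ := ih hx
      have hβ := B.restr.braidPast_mem_tmulDegree c hx
      -- The witnesses are read off the recursion for (a x) ∗ c: the terms with c inserted go to the
      -- first, raising the degree, and those with c multiplied into a letter go to the second.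
      refine ⟨TensorAlgebra.ι K a * y +
          BraidedAlgebra.prepend (B.restr.braidPast c (TensorAlgebra.ι K a * x)),
        add_mem (ι_mul_mem_tensorDegree _ hy) (prepend_mem_tensorDegree
          (B.restr.braidPast_mem_tmulDegree c (ι_mul_mem_tensorDegree _ hx))),
        TensorAlgebra.ι K a * z +
          BraidedAlgebra.prepend (mergeFirst B.restr.m _ (a ⊗ₜ B.restr.braidPast c x)),
        add_mem (ι_mul_mem_tensorDegree _ hz) (prepend_mem_tensorDegree
          (mergeFirst_mem_tmulDegree _ _ hβ)), ?_, fun u => ⟨?_, ?_⟩⟩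
      · rw [BraidedAlgebra.qsMul_ι_mul_ι, e, mul_add]; abel
      · rw [braidSum_zero_succ, LinearMap.add_apply,
          opRun_incl B (ι_mul_mem_tensorDegree _ hx), map_mul B.incl, incl_ι, mul_assoc, braidSum_succ,
          (h u).1, map_add, map_mul B.incl, incl_ι, add_mul, mul_assoc]
      -- The 𝟏 produced inside x is carried past a by σ(a ⊗ 𝟏) = 𝟏 ⊗ a, while a multiplication with
      -- a itself produces it in front already.
      · rw [virtSum_zero_succ, LinearMap.add_apply, Module.End.mul_apply, Module.End.mul_apply,
          map_mul B.incl, incl_ι, mul_assoc, virtSum_succ, (h u).2, tensorLocalOp_σ_one, opRun_succ _ 0,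
          opRun_incl B hx, tensorLocalOp_σm_incl, map_add, map_mul B.incl, incl_ι, add_mul, mul_add,
          mul_assoc]

end UnitalBraidedAlgebra

/-! ### The grading of K[GVB] by virtual length and the summed lifting step -/

section VirtualDegree

variable (K : Type u) [Field K]

/-- The elements of `K[GVB_n^+]` that are homogeneous of virtual length `l`. -/
def virtDegree (n l : ℕ) : Submodule K (MonoidAlgebra K (GVB n)) :=
  Submodule.span K (MonoidAlgebra.of K (GVB n) '' {τ | (virtLength n τ).toAdd = l})

variable {K}

theorem of_mem_virtDegree {n l : ℕ} {τ : GVB n} (h : (virtLength n τ).toAdd = l) :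
    MonoidAlgebra.of K (GVB n) τ ∈ virtDegree K n l :=
  Submodule.subset_span ⟨τ, h, rfl⟩

theorem one_mem_virtDegree (n : ℕ) : (1 : MonoidAlgebra K (GVB n)) ∈ virtDegree K n 0 := by
  rw [← map_one (MonoidAlgebra.of K (GVB n))]
  exact of_mem_virtDegree (by simp)

theorem mul_mem_virtDegree {n k l : ℕ} {x y : MonoidAlgebra K (GVB n)}
    (hx : x ∈ virtDegree K n k) (hy : y ∈ virtDegree K n l) : x * y ∈ virtDegree K n (k + l) := by
  have h := Submodule.mul_mem_mul hx hy
  rw [virtDegree, virtDegree, Submodule.span_mul_span] at h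
  refine Submodule.span_mono ?_ h
  rintro _ ⟨_, ⟨σ, hσ, rfl⟩, _, ⟨τ, hτ, rfl⟩, rfl⟩
  refine ⟨σ * τ, ?_, map_mul _ _ _⟩
  simp only [Set.mem_ofPred_eq] at hσ hτ ⊢
  rw [map_mul, toAdd_mul, hσ, hτ]

theorem braidElt_mem_virtDegree (n i : ℕ) : braidElt K n i ∈ virtDegree K n 0 := by
  rw [braidElt]
  split_ifs with h
  · exact of_mem_virtDegree (by simp [virtLength])
  · exact zero_mem _

theorem virtElt_mem_virtDegree (n i : ℕ) : virtElt K n i ∈ virtDegree K n 1 := by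
  rw [virtElt]
  split_ifs with h
  · exact of_mem_virtDegree (by simp [virtLength])
  · exact zero_mem _

variable (K)

/-- The run `σ_{a+1} ⋯ σ_b`. -/
def eltRun (n a b : ℕ) : MonoidAlgebra K (GVB n) :=
  ((List.Ico a b).map fun i => braidElt K n (i + 1)).prod

/-- The sum of the runs `σ_{l+t+1} ⋯ σ_{l+p}`, `0 ≤ t ≤ p`. -/
def braidEltSum (n l p : ℕ) : MonoidAlgebra K (GVB n) :=
  ∑ t ∈ Finset.range (p + 1), eltRun K n (l + t) (l + p)

/-- The sum of the products `(σ_{l+1} ⋯ σ_{l+t}) ξ_{l+t+1} (σ_{l+t+2} ⋯ σ_{l+p})`,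
`0 ≤ t < p`. -/
def virtEltSum (n l p : ℕ) : MonoidAlgebra K (GVB n) :=
  ∑ t ∈ Finset.range p,
    eltRun K n l (l + t) * virtElt K n (l + t + 1) * eltRun K n (l + t + 1) (l + p)

variable {K}

theorem eltRun_mem_virtDegree (n a b : ℕ) : eltRun K n a b ∈ virtDegree K n 0 := by
  rw [eltRun]
  induction List.Ico a b with
  | nil => simpa using one_mem_virtDegree n
  | cons i L ih =>
    rw [List.map_cons, List.prod_cons]
    have h := mul_mem_virtDegree (braidElt_mem_virtDegree n (i + 1)) ih
    rwa [add_zero] at h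

theorem braidEltSum_mem_virtDegree (n l p : ℕ) : braidEltSum K n l p ∈ virtDegree K n 0 := by
  rw [braidEltSum]
  exact Submodule.sum_mem _ fun _ _ => eltRun_mem_virtDegree _ _ _

theorem virtEltSum_mem_virtDegree (n l p : ℕ) : virtEltSum K n l p ∈ virtDegree K n 1 := by
  rw [virtEltSum]
  refine Submodule.sum_mem _ fun t _ => ?_
  have h1 := mul_mem_virtDegree (eltRun_mem_virtDegree (K := K) n l (l + t))
    (virtElt_mem_virtDegree n (l + t + 1))
  have h2 := mul_mem_virtDegree h1 (eltRun_mem_virtDegree n (l + t + 1) (l + p))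
  rwa [zero_add, add_zero] at h2

theorem arrow_braidElt {n l p i : ℕ} (h : l + (p + 1) ≤ n) (h1 : 1 ≤ i) (hp : i ≤ p) :
    MonoidAlgebra.mapDomainAlgHom K K (arrow l h) (braidElt K (p + 1) i) =
      braidElt K n (l + i) := by
  rw [braidElt, braidElt, dif_pos ⟨h1, by omega⟩, dif_pos (by omega)]
  simp [arrow, arrowGen]

theorem arrow_virtElt {n l p i : ℕ} (h : l + (p + 1) ≤ n) (h1 : 1 ≤ i) (hp : i ≤ p) :
    MonoidAlgebra.mapDomainAlgHom K K (arrow l h) (virtElt K (p + 1) i) =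
      virtElt K n (l + i) := by
  rw [virtElt, virtElt, dif_pos ⟨h1, by omega⟩, dif_pos (by omega)]
  simp [arrow, arrowGen]

theorem arrow_braidRun {n l p a b : ℕ} (h : l + (p + 1) ≤ n) (hb : b ≤ p) :
    MonoidAlgebra.mapDomainAlgHom K K (arrow l h) (braidRun K (p + 1) (a + 1) b) =
      eltRun K n (l + a) (l + b) := by
  have h1 : List.Ico (a + 1) (b + 1) = (List.Ico a b).map (1 + ·) := (List.Ico.map_add a b 1).symm
  have h2 : List.Ico (l + a) (l + b) = (List.Ico a b).map (l + ·) := by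
    rw [List.Ico.map_add, Nat.add_comm l, Nat.add_comm l]
  rw [braidRun, eltRun, h1, h2, map_list_prod, List.map_map, List.map_map, List.map_map]
  congr 1
  refine List.map_congr_left fun i hi => ?_
  rw [List.Ico.mem] at hi
  simp only [Function.comp_apply]
  rw [arrow_braidElt h (by omega) (by omega), Nat.add_comm 1 i, Nat.add_assoc]

/-- Each nontrivial run contributes one braid term and one virtual term; the identity, at `t = 0`,
matches the empty run, which is the last summand of `braidEltSum`. -/
theorem sum_arrow_bubbleLift {n l p : ℕ} (h : l + (p + 1) ≤ n) :
    ∑ t ∈ Finset.range (p + 1), MonoidAlgebra.mapDomainAlgHom K K (arrow l h) (bubbleLift K p t) =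
      braidEltSum K n l p + virtEltSum K n l p := by
  rw [Finset.sum_range_succ', braidEltSum, Finset.sum_range_succ, virtEltSum, add_right_comm,
    ← Finset.sum_add_distrib]
  congr 1
  · refine Finset.sum_congr rfl fun t ht => ?_
    rw [Finset.mem_range] at ht
    have hr : eltRun K n (l + t) (l + p) =
        braidElt K n (l + t + 1) * eltRun K n (l + t + 1) (l + p) := by
      rw [eltRun, List.Ico.eq_cons (by omega), List.map_cons, List.prod_cons, eltRun]
    have h0 : MonoidAlgebra.mapDomainAlgHom K K (arrow l h) (braidRun K (p + 1) 1 t) =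
        eltRun K n l (l + t) := arrow_braidRun (a := 0) h ht.le
    rw [bubbleLift, if_neg (by omega), map_mul, map_add, map_mul, arrow_braidElt h (by omega) ht,
      arrow_virtElt h (by omega) ht, arrow_braidRun h le_rfl, Nat.add_sub_cancel,
      h0, hr, add_mul]
    rfl
  · simp [bubbleLift, eltRun]

/-- `liftStep` depends on τ beyond right multiplication only through its virtual length. On a
homogeneous element the summed step is therefore left multiplication by a fixed element. -/
theorem sum_liftStep_bubble {n k l p : ℕ} (hlp : l + p = k) (hp : 1 ≤ p) (hk : k < n)
    {x : MonoidAlgebra K (GVB n)} (hx : x ∈ virtDegree K n l) :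
    ∑ t ∈ Finset.range (k + 1), liftStep K n k 1 (bubble n k t) x =
      (braidEltSum K n l p + virtEltSum K n l p) * x := by
  induction hx using Submodule.span_induction with
  | zero => simp
  | add x y _ _ hx hy => simp only [map_add, Finset.sum_add_distrib, mul_add, hx, hy]
  | smul c x _ hx => simp only [map_smul, ← Finset.smul_sum, hx, mul_smul_comm]
  | mem x h =>
    obtain ⟨τ, hτ, rfl⟩ := h
    rw [← sum_arrow_bubbleLift (by omega), ← sum_liftStepMonoid_bubble K τ hτ hlp hp hk]
    refine Finset.sum_congr rfl fun t _ => ?_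
    simp [liftStep]

end VirtualDegree

/-! ### Symmetrization as iterated product, and the conclusion -/

namespace UnitalBraidedAlgebra

variable {K : Type u} [Field K] {W : Type v} [AddCommGroup W] [Module K W]
variable (B : UnitalBraidedAlgebra K W)

/-- The element `x` of `K[GVB_n^+]` acts on `W^{⊗n}` as the operator `g` on `T(W)`. -/
def ActsAs (n : ℕ) (x : MonoidAlgebra K (GVB n)) (g : Module.End K (TensorAlgebra K W)) : Prop :=
  ∀ X : ⨂[K]^n W, TensorPower.toTensorAlgebra (B.actAlg n x X) = g (TensorPower.toTensorAlgebra X)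

variable {B}

theorem ActsAs.one {n : ℕ} : B.ActsAs n 1 1 := fun X => by simp

theorem ActsAs.mul {n : ℕ} {x y : MonoidAlgebra K (GVB n)}
    {g h : Module.End K (TensorAlgebra K W)} (hx : B.ActsAs n x g) (hy : B.ActsAs n y h) :
    B.ActsAs n (x * y) (g * h) := fun X => by
  rw [map_mul, Module.End.mul_apply, hx, hy, Module.End.mul_apply]

theorem ActsAs.sum {n : ℕ} {ι : Type*} (s : Finset ι) {x : ι → MonoidAlgebra K (GVB n)}
    {g : ι → Module.End K (TensorAlgebra K W)} (h : ∀ i ∈ s, B.ActsAs n (x i) (g i)) :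
    B.ActsAs n (∑ i ∈ s, x i) (∑ i ∈ s, g i) := fun X => by
  rw [map_sum, LinearMap.sum_apply, LinearMap.sum_apply, map_sum]
  exact Finset.sum_congr rfl fun i hi => h i hi X

theorem ActsAs.braidElt {n i : ℕ} (h : i + 1 < n) :
    B.ActsAs n (braidElt K n (i + 1)) (tensorLocalOp B.σ i) := fun X => by
  rw [QuasiShuffle.braidElt, dif_pos ⟨by omega, h⟩, tensorLocalOp_toTensorAlgebra]
  simp [actAlg, act, actGen]

theorem ActsAs.virtElt {n i : ℕ} (h : i + 1 < n) :
    B.ActsAs n (virtElt K n (i + 1)) (tensorLocalOp B.σm i) := fun X => by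
  rw [QuasiShuffle.virtElt, dif_pos ⟨by omega, h⟩, tensorLocalOp_toTensorAlgebra]
  simp [actAlg, act, actGen]

theorem ActsAs.eltRun {n a b : ℕ} (h : b < n) : B.ActsAs n (eltRun K n a b) (opRun B.σ a b) := by
  rw [QuasiShuffle.eltRun, opRun]
  have : ∀ i ∈ List.Ico a b, i + 1 < n := fun i hi => by
    rw [List.Ico.mem] at hi
    omega
  generalize List.Ico a b = L at this ⊢
  induction L with
  | nil => exact ActsAs.one
  | cons i L ih =>
    exact (ActsAs.braidElt (this i (by simp))).mul (ih fun j hj => this j (by simp [hj]))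

theorem ActsAs.braidEltSum {n l p : ℕ} (h : l + p < n) :
    B.ActsAs n (braidEltSum K n l p) (braidSum B.σ l p) :=
  ActsAs.sum _ fun _ _ => ActsAs.eltRun h

theorem ActsAs.virtEltSum {n l p : ℕ} (h : l + p < n) :
    B.ActsAs n (virtEltSum K n l p) (virtSum B.σ B.σm l p) :=
  ActsAs.sum _ fun t ht => by
    rw [Finset.mem_range] at ht
    exact ((ActsAs.eltRun (by omega)).mul (ActsAs.virtElt (by omega))).mul (ActsAs.eltRun h)

variable (B)

/-- The iterated product `v_0 ∗ v_1 ∗ ⋯ ∗ v_{k-1}`. -/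
def qsProd (v : ℕ → B.V) : ℕ → TensorAlgebra K B.V
  | 0 => 1
  | k + 1 => B.restr.qsMul (qsProd v k) (TensorAlgebra.ι K (v k))

/-- The concatenation `v_k ⊗ ⋯ ⊗ v_{n-1}` in `T(W)`. -/
def tailProd (v : ℕ → B.V) (k n : ℕ) : TensorAlgebra K W :=
  ((List.Ico k n).map fun i => TensorAlgebra.ι K (v i : W)).prod

theorem tailProd_eq_mul (v : ℕ → B.V) {k n : ℕ} (h : k < n) :
    B.tailProd v k n = TensorAlgebra.ι K (v k : W) * B.tailProd v (k + 1) n := by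
  rw [tailProd, List.Ico.eq_cons h, List.map_cons, List.prod_cons, tailProd]

/-- The span of the pairs of an element `x` of virtual length `l` and a tensor `φ` of degree
`k + 1 - l`, such that `x` transforms `v_0 ⊗ ⋯ ⊗ v_{n-1}` into
`𝟏^{⊗l} ⊗ φ ⊗ v_{k+1} ⊗ ⋯ ⊗ v_{n-1}`. -/
def partialSymm (v : ℕ → B.V) (n k : ℕ) (X : ⨂[K]^n W) :
    Submodule K (MonoidAlgebra K (GVB n) × TensorAlgebra K B.V) :=
  Submodule.span K {P | ∃ l p, l + p = k + 1 ∧ 1 ≤ p ∧ P.1 ∈ virtDegree K n l ∧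
    P.2 ∈ tensorDegree K B.V p ∧ TensorPower.toTensorAlgebra (B.actAlg n P.1 X) =
      TensorAlgebra.ι K B.one ^ l * (B.incl P.2 * B.tailProd v (k + 1) n)}

/-- One lifting step and one multiplication by the next vector match each other. The span is taken
of pairs so that the mixed virtual lengths of Q_n are split compatibly with the degrees of the
product. -/
theorem step_mem_partialSymm (v : ℕ → B.V) {n k : ℕ} (h : k + 1 < n) (X : ⨂[K]^n W)
    {P : MonoidAlgebra K (GVB n) × TensorAlgebra K B.V} (hP : P ∈ B.partialSymm v n k X) :
    (∑ t ∈ Finset.range (k + 2), liftStep K n (k + 1) 1 (bubble n (k + 1) t) P.1,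
      B.restr.qsMul P.2 (TensorAlgebra.ι K (v (k + 1)))) ∈ B.partialSymm v n (k + 1) X := by
  induction hP using Submodule.span_induction with
  | zero =>
    simp only [Prod.fst_zero, Prod.snd_zero, map_zero, LinearMap.zero_apply,
      Finset.sum_const_zero, Prod.mk_zero_zero]
    exact zero_mem _
  | add P Q _ _ hP hQ =>
    simp only [Prod.fst_add, Prod.snd_add, map_add, LinearMap.add_apply, Finset.sum_add_distrib]
    rw [← Prod.mk_add_mk]
    exact add_mem hP hQ
  | smul c P _ hP =>
    simp only [Prod.smul_fst, Prod.smul_snd, map_smul, LinearMap.smul_apply, ← Finset.smul_sum]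
    rw [← Prod.smul_mk]
    exact Submodule.smul_mem _ c hP
  | mem P hP =>
    obtain ⟨l, p, hlp, hp, h1, h2, h3⟩ := hP
    obtain ⟨y, hy, z, hz, e, hu⟩ := B.exists_qsMul_ι_eq h2 (v (k + 1))
    obtain ⟨hb, hv⟩ := hu (B.tailProd v (k + 1 + 1) n)
    rw [sum_liftStep_bubble hlp hp h h1, e, add_mul, ← Prod.mk_add_mk]
    rw [B.tailProd_eq_mul v h] at h3
    -- The braid part keeps `l` and lengthens the tensor; the virtual part adds one 𝟏 and keeps the
    -- length `p`. In particular `p ≥ 1` persists, so the condition `l < k` in M_{k,1} always holds.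
    refine add_mem (Submodule.subset_span ⟨l, p + 1, by omega, by omega, ?_, hy, ?_⟩)
      (Submodule.subset_span ⟨l + 1, p, by omega, hp, ?_, hz, ?_⟩)
    · simpa using mul_mem_virtDegree (braidEltSum_mem_virtDegree n l p) h1
    · rw [map_mul, Module.End.mul_apply, ActsAs.braidEltSum (by omega), h3, braidSum_pow_mul, hb]
    · simpa [Nat.add_comm] using mul_mem_virtDegree (virtEltSum_mem_virtDegree n l p) h1
    · rw [map_mul, Module.End.mul_apply, ActsAs.virtEltSum (by omega), h3, virtSum_pow_mul, hv,
        pow_succ, mul_assoc]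

theorem symmIter_mem_partialSymm (v : ℕ → B.V) {n : ℕ} (X : ⨂[K]^n W)
    (hX : TensorPower.toTensorAlgebra X = B.tailProd v 0 n) (k : ℕ) (h : k < n) :
    (symmIter K n k, B.qsProd v (k + 1)) ∈ B.partialSymm v n k X := by
  induction k with
  | zero =>
    refine Submodule.subset_span ⟨0, 1, rfl, le_rfl, one_mem_virtDegree n, ?_, ?_⟩
    · rw [tensorDegree, pow_one]
      exact ⟨v 0, by simp [qsProd, BraidedAlgebra.qsMul_one_left]⟩
    · simp [symmIter, qsProd, BraidedAlgebra.qsMul_one_left, hX, B.tailProd_eq_mul v h]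
  | succ k ih =>
    have hs := B.step_mem_partialSymm v h X (ih (by omega))
    rw [symmIter, qsProd]
    exact hs

/-- No untreated letters remain, and deleting turns 𝟏^{⊗l} ⊗ φ into φ for every `l`; by linearity
the mixture of virtual lengths does not matter. -/
theorem deleting_partialSymm (v : ℕ → B.V) {n k : ℕ} (h : n ≤ k + 1) (X : ⨂[K]^n W)
    {P : MonoidAlgebra K (GVB n) × TensorAlgebra K B.V} (hP : P ∈ B.partialSymm v n k X) :
    B.deleting (TensorPower.toTensorAlgebra (B.actAlg n P.1 X)) = P.2 := by
  induction hP using Submodule.span_induction with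
  | zero => simp
  | add P Q _ _ hP hQ => simp only [Prod.fst_add, Prod.snd_add, map_add, LinearMap.add_apply, hP, hQ]
  | smul c P _ hP => simp only [Prod.smul_fst, Prod.smul_snd, map_smul, LinearMap.smul_apply, hP]
  | mem P hP =>
    obtain ⟨l, p, -, -, -, -, h3⟩ := hP
    rw [h3, tailProd, List.Ico.eq_nil_of_le h]
    simp [deleting_one, deleting_incl]

theorem QS_toTensorAlgebra (n : ℕ) (x : ⨂[K]^n B.V) :
    B.QS (TensorPower.toTensorAlgebra x) = B.QSn n x := by
  rw [QS, LinearMap.comp_apply, AlgEquiv.toLinearMap_apply, equivDirectSum_toTensorAlgebra]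
  erw [DirectSum.toModule_lof]

/-- After the last step the invariant pairs Q_n with the iterated product, and deleting the 𝟏's
recovers the latter. -/
theorem QS_prod (v : ℕ → B.V) (n : ℕ) :
    B.QS ((List.ofFn fun i : Fin n => TensorAlgebra.ι K (v i)).prod) = B.qsProd v n := by
  rw [← TensorAlgebra.tprod_apply, ← TensorPower.toTensorAlgebra_tprod, QS_toTensorAlgebra, QSn]
  simp only [LinearMap.comp_apply, PiTensorProduct.map_tprod, AlgHom.toLinearMap_apply]
  cases n with
  | zero =>
    have : totalSymmElt K 0 = 1 := by simp [totalSymmElt, lift, liftIter]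
    rw [this]
    simp [TensorAlgebra.tprod_apply, qsProd]
  | succ n =>
    rw [totalSymmElt_succ]
    generalize hX' : (PiTensorProduct.tprod K fun i : Fin (n + 1) => B.V.subtype (v i)) = X
    have hX : TensorPower.toTensorAlgebra X = B.tailProd v 0 (n + 1) := ?_
    · have hs := B.symmIter_mem_partialSymm v X hX n (Nat.lt_succ_self n)
      have hd := B.deleting_partialSymm v le_rfl X hs
      dsimp only at hd
      exact hd
    subst hX'
    rw [TensorPower.toTensorAlgebra_tprod, TensorAlgebra.tprod_apply, tailProd, List.Ico.zero_bot]
    congr 1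
    rw [← List.map_coe_finRange_eq_range, List.map_map, List.ofFn_eq_map]
    rfl

theorem QS_one : B.QS 1 = 1 := by
  simpa [qsProd] using B.QS_prod (fun _ => 0) 0

/-- The total symmetrization operator turns concatenation into the quantum quasi-shuffle
product. -/
theorem QS_mul_ι (x : TensorAlgebra K B.V) (c : B.V) :
    B.QS (x * TensorAlgebra.ι K c) = B.restr.qsMul (B.QS x) (TensorAlgebra.ι K c) := by
  induction x using tensorAlgebra_induction_homogeneous with
  | add x y hx hy => simp only [add_mul, map_add, LinearMap.add_apply, hx, hy]
  | homogeneous n x =>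
    induction x using PiTensorProduct.induction_on with
    | add x y hx hy => simp only [add_mul, map_add, LinearMap.add_apply, hx, hy]
    | smul_tprod r f =>
      -- The given factors followed by c: position n carries c, so the two instances of `QS_prod`
      -- differ by one multiplication by c.
      let v : ℕ → B.V := fun i => if h : i < n then f ⟨i, h⟩ else c
      have h1 := B.QS_prod v n
      have h2 := B.QS_prod v (n + 1)
      rw [qsProd, ← h1, List.ofFn_succ_last, List.prod_append] at h2
      simpa [v, TensorAlgebra.tprod_apply] using congrArg (r • ·) h2

theorem quasiShuffleAlgebra_eq_range_QS : B.restr.quasiShuffleAlgebra = LinearMap.range B.QS := by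
  apply le_antisymm
  · refine sInf_le ⟨⟨1, B.QS_one⟩, fun c => ⟨TensorAlgebra.ι K c, ?_⟩, ?_⟩
    · rw [← one_mul (TensorAlgebra.ι K c), QS_mul_ι, QS_one, BraidedAlgebra.qsMul_one_left,
        one_mul]
    · rintro x ⟨x', rfl⟩ _ ⟨y, rfl⟩
      induction y using BraidedAlgebra.tensorAlgebra_induction_right with
      | one => rw [QS_one, BraidedAlgebra.qsMul_one_right]; exact ⟨x', rfl⟩
      | add y z hy hz => rw [map_add, map_add]; exact add_mem hy hz
      | smul k y hy => rw [map_smul, map_smul]; exact Submodule.smul_mem _ _ hy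
      | mul_ι y c hy =>
        obtain ⟨z, hz⟩ := hy
        -- QS(x') ∗ (QS(y) ∗ c) = (QS(x') ∗ QS(y)) ∗ c = QS(z) ∗ c = QS(z c).
        rw [QS_mul_ι, ← BraidedAlgebra.qsMul_assoc_ι, ← hz, ← QS_mul_ι]
        exact ⟨_, rfl⟩
  · refine le_sInf ?_
    rintro S ⟨h1, hι, hmul⟩ _ ⟨y, rfl⟩
    induction y using BraidedAlgebra.tensorAlgebra_induction_right with
    | one => rwa [QS_one]
    | add y z hy hz => rw [map_add]; exact add_mem hy hz
    | smul k y hy => rw [map_smul]; exact Submodule.smul_mem _ _ hy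
    | mul_ι y c hy => rw [QS_mul_ι]; exact hmul _ hy _ (hι c)

end UnitalBraidedAlgebra
end QuasiShuffle

end

theorem mainTheorem6 {K : Type*} [Field K] {W : Type*} [AddCommGroup W] [Module K W]
    (B : QuasiShuffle.UnitalBraidedAlgebra K W) :
    B.restr.quasiShuffleAlgebra = LinearMap.range B.QS :=
  B.quasiShuffleAlgebra_eq_range_QS
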